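/- Let $(\mathcal{C},\mathbb{E},\mathfrak{s})$ be an extriangulated category (in the sense of Nakaoka–Palu) with higher extension groups. This means that one of the following holds: $\mathcal{C}$ has enough $\mathbb{E}$-projectives and enough $\mathbb{E}$-injectives, in which case $\mathbb{E}^{k+1}(X,Y):=\mathbb{E}(X,\Sigma^{k}Y)$ for $k\ge 0$, where $\Sigma^kY$ is a $k$-th cosyzygy of $Y$; or $\mathcal{C}$ is an abelian category with its usual extriangulated structure (conflations are the short exact sequences), in which case $\mathbb{E}^k=\mathrm{Ext}^k_{\mathcal{C}}$ is Yoneda's functor; or $\mathcal{C}$ is a triangulated category with its usual extriangulated structure ($\mathbb{E}(X,Y)=\mathrm{Hom}_{\mathcal C}(X,Y[1])$, conflations come from the distinguished triangles), in which case $\mathbb{E}^k(X,Y)=\mathrm{Hom}_{\mathcal{C}}(X,Y[k])$. For classes $\mathcal{X},\mathcal{Y}$ of objects of $\mathcal{C}$ put $\mathrm{id}_{\mathcal{X}}(M):=\min\{m\ge 0: \mathbb{E}^{k}(X,M)=0 \text{ for all } k\ge m+1,\ X\in\mathcal{X}\}$ (with $\min\emptyset=\infty$) and $\mathrm{id}_{\mathcal{X}}(\mathcal{Y}):=\sup_{M\in\mathcal{Y}}\mathrm{id}_{\mathcal{X}}(M)$.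 Let $\mathcal{X}^{\wedge}$ be the class of all objects $M$ with a finite $\mathcal{X}$-resolution $0\to X_n\to\cdots\to X_0\to M\to 0$, that is, for which there are $n\ge 0$ and conflations $Z_{i+1}\to X_i\to Z_i$ $(0\le i<n)$ with $Z_0=M$, $Z_n\simeq X_n$ and $X_0,\dots,X_n\in\mathcal{X}$. A class of objects is left thick if it contains a zero object and is closed under extensions, direct summands in $\mathcal{C}$ and cocones (if $X\to Y\to Z$ is a conflation with $Y,Z$ in the class, then $X$ is in the class). It is thick if it is left thick and also closed under cones (if $X\to Y\to Z$ is a conflation with $X,Y$ in the class, then $Z$ is in the class). $\mathsf{Thick}(\mathcal{F})$ is the smallest thick class containing $\mathcal{F}$; as it contains a zero object and is closed under extensions, it is an extriangulated category with the restrictions of $\mathbb{E}$ and $\mathfrak{s}$. A left Frobenius pair in $\mathcal{C}$ is a pair $(\mathcal{X},\omega)$ of classes of objects such that $\mathcal{X}$ is left thick, $\omega$ is closed under direct summands in $\mathcal{C}$, $\mathrm{id}_{\mathcal{X}}(\omega)=0$, $\omega\subseteq\mathcal{X}$, and every $X\in\mathcal{X}$ admits a conflation $X\to W\to X'$ with $W\in\omega$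 and $X'\in\mathcal{X}$. A cotorsion pair in an extriangulated category $(\mathcal{D},\mathbb{E},\mathfrak{s})$ is a pair $(\mathcal{U},\mathcal{V})$ of classes of objects of $\mathcal{D}$, closed under direct summands in $\mathcal{D}$, such that $\mathbb{E}(U,V)=0$ for all $U\in\mathcal{U}$, $V\in\mathcal{V}$, and such that every $D\in\mathcal{D}$ admits conflations $V\to U\to D$ and $D\to V'\to U'$ with $U,U'\in\mathcal{U}$ and $V,V'\in\mathcal{V}$. Then the maps $(\mathcal{X},\omega)\mapsto(\mathcal{X},\omega^{\wedge})$ and $(\mathcal{F},\mathcal{G})\mapsto(\mathcal{F},\mathcal{F}\cap\mathcal{G})$ are well defined, mutually inverse bijections between 1. the left Frobenius pairs $(\mathcal{X},\omega)$ in $\mathcal{C}$, and 2. the cotorsion pairs $(\mathcal{F},\mathcal{G})$ in the extriangulated category $\mathsf{Thick}(\mathcal{F})$ with $\mathrm{id}_{\mathcal{F}}(\mathcal{G})=0$, where $\mathrm{id}_{\mathcal F}$ is taken in $\mathcal{C}$. -/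

import Mathlib

open CategoryTheory CategoryTheory.Limits Opposite

universe w v u

noncomputable section

namespace Extri

/-! ### Extensions and sequences -/

section Extensions

variable {C : Type u} [Category.{v} C]

/-- `𝔼(Z, A)`, the group of extensions of `Z` by `A`. -/
abbrev Extn (E : Cᵒᵖ ⥤ C ⥤ AddCommGrpCat.{w}) (Z A : C) : AddCommGrpCat.{w} :=
  (E.obj (op Z)).obj A

/-- `a δ = 𝔼(Z, a)(δ)`. -/
def push (E : Cᵒᵖ ⥤ C ⥤ AddCommGrpCat.{w}) {Z A A' : C} (a : A ⟶ A') (δ : Extn E Z A) :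
    Extn E Z A' :=
  ((E.obj (op Z)).map a) δ

/-- `δ c = 𝔼(c, A)(δ)`. -/
def pull (E : Cᵒᵖ ⥤ C ⥤ AddCommGrpCat.{w}) {Z Z' A : C} (c : Z' ⟶ Z) (δ : Extn E Z A) :
    Extn E Z' A :=
  ((E.map c.op).app A) δ

/-- Sequences of morphisms `A ⟶ B ⟶ Z` with fixed ends. -/
structure Seq (A Z : C) where
  mid : C
  x : A ⟶ mid
  y : mid ⟶ Z

/-- Two sequences `A ⟶ B ⟶ Z` and `A ⟶ B' ⟶ Z` are equivalent if there is an isomorphism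
`B ≅ B'` compatible with the morphisms. -/
instance seqSetoid (A Z : C) : Setoid (Seq A Z) where
  r p q := ∃ b : p.mid ≅ q.mid, p.x ≫ b.hom = q.x ∧ b.hom ≫ q.y = p.y
  iseqv :=
    { refl := fun p => ⟨Iso.refl _, by simp, by simp⟩
      symm := by
        rintro p q ⟨b, h₁, h₂⟩
        exact ⟨b.symm, by simp [← h₁], by simp [← h₂]⟩
      trans := by
        rintro p q r ⟨b, h₁, h₂⟩ ⟨b', h₁', h₂'⟩
        exact ⟨b ≪≫ b', by simp [← h₁', ← h₁], by simp [← h₂', ← h₂]⟩ }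

/-- Equivalence classes `[A ⟶ B ⟶ Z]`. -/
abbrev SeqClass (A Z : C) : Type (max u v) := Quotient (seqSetoid A Z)

/-- The class `[A ⟶ B ⟶ Z]`. -/
def seqClass {A B Z : C} (x : A ⟶ B) (y : B ⟶ Z) : SeqClass A Z := Quotient.mk _ ⟨B, x, y⟩

lemma seqClass_eq_iff {A B B' Z : C} (x : A ⟶ B) (y : B ⟶ Z) (x' : A ⟶ B') (y' : B' ⟶ Z) :
    seqClass x y = seqClass x' y' ↔ ∃ b : B ≅ B', x ≫ b.hom = x' ∧ b.hom ≫ y' = y :=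
  Quotient.eq (r := seqSetoid A Z)

lemma exists_seqClass {A Z : C} (q : SeqClass A Z) :
    ∃ (B : C) (x : A ⟶ B) (y : B ⟶ Z), q = seqClass x y := by
  induction q using Quotient.inductionOn with
  | h p => exact ⟨p.mid, p.x, p.y, rfl⟩

end Extensions

section DirectSums

variable {C : Type u} [Category.{v} C] [Preadditive C]

/-- In a preadditive category, this equation says that the binary bicone `b` over `A` and `A'`
exhibits `b.pt` as a biproduct `A ⊕ A'`. -/
def IsDirectSum {A A' : C} (b : BinaryBicone A A') : Prop :=
  b.fst ≫ b.inl + b.snd ≫ b.inr = 𝟙 b.pt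

/-- The morphism `x ⊕ x' : A ⊕ A' ⟶ B ⊕ B'`. -/
def sumMap {A A' B B' : C} (bA : BinaryBicone A A') (bB : BinaryBicone B B')
    (x : A ⟶ B) (x' : A' ⟶ B') : bA.pt ⟶ bB.pt :=
  bA.fst ≫ x ≫ bB.inl + bA.snd ≫ x' ≫ bB.inr

/-- The extension `δ ⊕ δ' ∈ 𝔼(Z ⊕ Z', A ⊕ A')`, which corresponds to `(δ, 0, 0, δ')` in
`𝔼(Z, A) ⊕ 𝔼(Z, A') ⊕ 𝔼(Z', A) ⊕ 𝔼(Z', A')`. -/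
def sumExt (E : Cᵒᵖ ⥤ C ⥤ AddCommGrpCat.{w}) {A A' Z Z' : C} (bA : BinaryBicone A A')
    (bZ : BinaryBicone Z Z') (δ : Extn E Z A) (δ' : Extn E Z' A') : Extn E bZ.pt bA.pt :=
  push E bA.inl (pull E bZ.fst δ) + push E bA.inr (pull E bZ.snd δ')

end DirectSums

/-! ### Extriangulated categories -/

/-- An extriangulated structure `(𝔼, 𝔰)` on `C`; the first two fields say, together with
`Preadditive C`, that `C` is an additive category. -/
structure Extriangulated (C : Type u) [Category.{v} C] [Preadditive C] where
  hasZeroObject : HasZeroObject C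
  hasBinaryBiproducts : HasBinaryBiproducts C
  /-- (ET1) the additive bifunctor `𝔼`. -/
  E : Cᵒᵖ ⥤ C ⥤ AddCommGrpCat.{w}
  additive_left : E.Additive
  additive_right : ∀ Z : C, (E.obj (op Z)).Additive
  /-- The correspondence `𝔰` from extensions to equivalence classes of sequences. -/
  s : ∀ {Z A : C}, Extn E Z A → SeqClass A Z
  /-- `𝔰` is a realization of `𝔼`. -/
  realization : ∀ {A B Z A' B' Z' : C} (x : A ⟶ B) (y : B ⟶ Z) (x' : A' ⟶ B') (y' : B' ⟶ Z')
    (δ : Extn E Z A) (δ' : Extn E Z' A'), s δ = seqClass x y → s δ' = seqClass x' y' →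
    ∀ (a : A ⟶ A') (c : Z ⟶ Z'), push E a δ = pull E c δ' →
      ∃ b : B ⟶ B', x ≫ b = a ≫ x' ∧ y ≫ c = b ≫ y'
  /-- (ET2) `𝔰` is additive: split extensions. -/
  s_zero : ∀ {A Z : C} (b : BinaryBicone A Z), IsDirectSum b →
    s (0 : Extn E Z A) = seqClass b.inl b.snd
  /-- (ET2) `𝔰` is additive: direct sums. -/
  s_sum : ∀ {A B Z A' B' Z' : C} (x : A ⟶ B) (y : B ⟶ Z) (x' : A' ⟶ B') (y' : B' ⟶ Z')
    (δ : Extn E Z A) (δ' : Extn E Z' A'), s δ = seqClass x y → s δ' = seqClass x' y' →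
    ∀ (bA : BinaryBicone A A') (bB : BinaryBicone B B') (bZ : BinaryBicone Z Z'),
      IsDirectSum bA → IsDirectSum bB → IsDirectSum bZ →
      s (sumExt E bA bZ δ δ') = seqClass (sumMap bA bB x x') (sumMap bB bZ y y')
  /-- (ET3) -/
  et3 : ∀ {A B Z A' B' Z' : C} (x : A ⟶ B) (y : B ⟶ Z) (x' : A' ⟶ B') (y' : B' ⟶ Z')
    (δ : Extn E Z A) (δ' : Extn E Z' A'), s δ = seqClass x y → s δ' = seqClass x' y' →
    ∀ (a : A ⟶ A') (b : B ⟶ B'), x ≫ b = a ≫ x' →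
      ∃ c : Z ⟶ Z', y ≫ c = b ≫ y' ∧ push E a δ = pull E c δ'
  /-- (ET3)ᵒᵖ -/
  et3_op : ∀ {A B Z A' B' Z' : C} (x : A ⟶ B) (y : B ⟶ Z) (x' : A' ⟶ B') (y' : B' ⟶ Z')
    (δ : Extn E Z A) (δ' : Extn E Z' A'), s δ = seqClass x y → s δ' = seqClass x' y' →
    ∀ (b : B ⟶ B') (c : Z ⟶ Z'), y ≫ c = b ≫ y' →
      ∃ a : A ⟶ A', x ≫ b = a ≫ x' ∧ push E a δ = pull E c δ'
  /-- (ET4) -/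
  et4 : ∀ {A B D M F : C} (f : A ⟶ B) (f' : B ⟶ D) (g : B ⟶ M) (g' : M ⟶ F)
    (δ : Extn E D A) (δ' : Extn E F B), s δ = seqClass f f' → s δ' = seqClass g g' →
    ∃ (K : C) (d : D ⟶ K) (e : K ⟶ F) (h : A ⟶ M) (h' : M ⟶ K) (δ'' : Extn E K A),
      f ≫ g = h ∧ f' ≫ d = g ≫ h' ∧ h' ≫ e = g' ∧
      s δ'' = seqClass h h' ∧ s (push E f' δ') = seqClass d e ∧
      pull E d δ'' = δ ∧ push E f δ'' = pull E e δ'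
  /-- (ET4)ᵒᵖ -/
  et4_op : ∀ {D A B F Z : C} (f' : D ⟶ A) (f : A ⟶ B) (g' : F ⟶ B) (g : B ⟶ Z)
    (δ : Extn E B D) (δ' : Extn E Z F), s δ = seqClass f' f → s δ' = seqClass g' g →
    ∃ (K : C) (d : D ⟶ K) (e : K ⟶ F) (h' : K ⟶ A) (h : A ⟶ Z) (δ'' : Extn E Z K),
      d ≫ h' = f' ∧ e ≫ g' = h' ≫ f ∧ f ≫ g = h ∧
      s δ'' = seqClass h' h ∧ s (pull E g' δ) = seqClass d e ∧
      δ' = push E e δ'' ∧ push E d δ = pull E g δ''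

namespace Extriangulated

variable {C : Type u} [Category.{v} C] [Preadditive C]

/-- The group `𝔼(Z, A)`. -/
abbrev Ext (S : Extriangulated.{w} C) (Z A : C) : AddCommGrpCat.{w} := Extn S.E Z A

/-- `A ⟶ B ⟶ Z` realizes `δ`, i.e. `A ⟶ B ⟶ Z ⇢ δ` is an `𝔼`-triangle. -/
def Realizes (S : Extriangulated.{w} C) {A B Z : C} (x : A ⟶ B) (y : B ⟶ Z)
    (δ : S.Ext Z A) : Prop :=
  S.s δ = seqClass x y

/-- `A ⟶ B ⟶ Z` is a conflation. -/
def IsConflation (S : Extriangulated.{w} C) {A B Z : C} (x : A ⟶ B) (y : B ⟶ Z) : Prop :=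
  ∃ δ : S.Ext Z A, S.Realizes x y δ

/-! ### Closure properties of classes of objects -/

/-- The class `P` contains a zero object. -/
def HasZero (P : ObjectProperty C) : Prop := ∃ Z : C, IsZero Z ∧ P Z

/-- Closure under direct summands in `C`. -/
def ClosedUnderSummands (P : ObjectProperty C) : Prop :=
  ∀ ⦃A A' : C⦄ (b : BinaryBicone A A'), IsDirectSum b → P b.pt → P A ∧ P A'

def ClosedUnderExtensions (S : Extriangulated.{w} C) (P : ObjectProperty C) : Prop :=
  ∀ ⦃A B Z : C⦄ (x : A ⟶ B) (y : B ⟶ Z), S.IsConflation x y → P A → P Z → P B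

def ClosedUnderCones (S : Extriangulated.{w} C) (P : ObjectProperty C) : Prop :=
  ∀ ⦃A B Z : C⦄ (x : A ⟶ B) (y : B ⟶ Z), S.IsConflation x y → P A → P B → P Z

def ClosedUnderCocones (S : Extriangulated.{w} C) (P : ObjectProperty C) : Prop :=
  ∀ ⦃A B Z : C⦄ (x : A ⟶ B) (y : B ⟶ Z), S.IsConflation x y → P B → P Z → P A

/-- Left thick subcategories. Like every subcategory of an additive category that is to be
additive, a left thick subcategory is required to contain a zero object; as it is closed under
direct summands, this only excludes the empty class. -/
structure IsLeftThick (S : Extriangulated.{w} C) (P : ObjectProperty C) : Prop where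
  hasZero : HasZero P
  extensions : S.ClosedUnderExtensions P
  summands : ClosedUnderSummands P
  cocones : S.ClosedUnderCocones P

/-- Right thick subcategories. -/
structure IsRightThick (S : Extriangulated.{w} C) (P : ObjectProperty C) : Prop where
  hasZero : HasZero P
  extensions : S.ClosedUnderExtensions P
  summands : ClosedUnderSummands P
  cones : S.ClosedUnderCones P

/-- Thick subcategories. -/
def IsThick (S : Extriangulated.{w} C) (P : ObjectProperty C) : Prop :=
  S.IsLeftThick P ∧ S.IsRightThick P

/-- `Thick(X)`, the smallest thick subcategory containing `X`. -/
def thick (S : Extriangulated.{w} C) (X : ObjectProperty C) : ObjectProperty C :=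
  fun M => ∀ T : ObjectProperty C, S.IsThick T → X ≤ T → T M

/-- `S.HasResolution X n M`: there is an `X`-resolution `0 ⟶ Xₙ ⟶ ⋯ ⟶ X₀ ⟶ M ⟶ 0` of
length `n`, that is, there are conflations `Zᵢ₊₁ ⟶ Xᵢ ⟶ Zᵢ` (`0 ≤ i < n`) with `Z₀ = M`,
`Zₙ ≅ Xₙ` and all `Xᵢ` in `X`. -/
def HasResolution (S : Extriangulated.{w} C) (X : ObjectProperty C) : ℕ → C → Prop
  | 0, M => ∃ X₀ : C, X X₀ ∧ Nonempty (X₀ ≅ M)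
  | n + 1, M => ∃ (K X₀ : C) (x : K ⟶ X₀) (y : X₀ ⟶ M),
      X X₀ ∧ S.IsConflation x y ∧ S.HasResolution X n K

/-- `X^∧`, the class of objects of finite `X`-resolution dimension. -/
def wedge (S : Extriangulated.{w} C) (X : ObjectProperty C) : ObjectProperty C :=
  fun M => ∃ n : ℕ, S.HasResolution X n M

/-- `ω` is a relative cogenerator in `X`. -/
def IsCogenerator (S : Extriangulated.{w} C) (ω X : ObjectProperty C) : Prop :=
  ω ≤ X ∧ ∀ M : C, X M → ∃ (W M' : C) (x : M ⟶ W) (y : W ⟶ M'),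
    ω W ∧ X M' ∧ S.IsConflation x y

/-! ### Cotorsion pairs -/

/-- Cotorsion pairs in an extriangulated category. -/
structure IsCotorsionPair (S : Extriangulated.{w} C) (U V : ObjectProperty C) : Prop where
  left_summands : ClosedUnderSummands U
  right_summands : ClosedUnderSummands V
  ext_zero : ∀ A B : C, U A → V B → ∀ δ : S.Ext A B, δ = 0
  left_complete : ∀ M : C, ∃ (B A : C) (x : B ⟶ A) (y : A ⟶ M),
    V B ∧ U A ∧ S.IsConflation x y
  right_complete : ∀ M : C, ∃ (B A : C) (x : M ⟶ B) (y : B ⟶ A),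
    V B ∧ U A ∧ S.IsConflation x y

/-! ### Projective and injective objects -/

def IsProjective (S : Extriangulated.{w} C) (P : C) : Prop :=
  ∀ ⦃A B Z : C⦄ (x : A ⟶ B) (y : B ⟶ Z), S.IsConflation x y →
    ∀ f : P ⟶ Z, ∃ g : P ⟶ B, g ≫ y = f

def IsInjective (S : Extriangulated.{w} C) (I : C) : Prop :=
  ∀ ⦃A B Z : C⦄ (x : A ⟶ B) (y : B ⟶ Z), S.IsConflation x y →
    ∀ f : A ⟶ I, ∃ g : B ⟶ I, x ≫ g = f

def EnoughProjectives (S : Extriangulated.{w} C) : Prop :=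
  ∀ M : C, ∃ (K P : C) (x : K ⟶ P) (y : P ⟶ M), S.IsProjective P ∧ S.IsConflation x y

def EnoughInjectives (S : Extriangulated.{w} C) : Prop :=
  ∀ M : C, ∃ (K I : C) (x : M ⟶ I) (y : I ⟶ K), S.IsInjective I ∧ S.IsConflation x y

/-- A cosyzygy `ΣM` of `M`: the third term of a chosen conflation `M ⟶ I ⟶ ΣM` with `I`
injective. -/
def cosyzygy (S : Extriangulated.{w} C) (h : S.EnoughInjectives) (M : C) : C := (h M).choose

/-- The `k`-th cosyzygy `Σᵏ M`. -/
def iterCosyzygy (S : Extriangulated.{w} C) (h : S.EnoughInjectives) : ℕ → C → C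
  | 0, M => M
  | k + 1, M => S.cosyzygy h (S.iterCosyzygy h k M)

end Extriangulated

/-! ### Higher extension groups -/

/-- The preadditive category `C` is abelian. -/
structure IsAbelianCategory (C : Type u) [Category.{v} C] [Preadditive C] : Prop where
  normalMono : IsNormalMonoCategory C
  normalEpi : IsNormalEpiCategory C
  finiteProducts : HasFiniteProducts C
  kernels : HasKernels C
  cokernels : HasCokernels C

/-- Mathlib's `Abelian` structure on an abelian category, over the given preadditive structure. -/
@[reducible] def IsAbelianCategory.abelian {C : Type u} [Category.{v} C] [Preadditive C]
    (h : IsAbelianCategory C) : Abelian C :=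
  { (inferInstance : Preadditive C), h.normalMono, h.normalEpi with
    has_finite_products := h.finiteProducts
    has_kernels := h.kernels
    has_cokernels := h.cokernels }

/-- The Yoneda group `Extⁿ(X, Y)` of an abelian category. -/
def yonedaExt {C : Type u} [Category.{v} C] [Preadditive C]
    (h : IsAbelianCategory C) (X Y : C) (n : ℕ) : AddCommGrpCat.{max u v} :=
  letI := h.abelian
  haveI := HasExt.standard.{v, u} C
  AddCommGrpCat.of (Abelian.Ext.{max u v} X Y n)

/-- The functoriality `ξ ↦ a ξ c` of `Ext¹`. -/
def yonedaExtMap {C : Type u} [Category.{v} C] [Preadditive C]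
    (h : IsAbelianCategory C) {X X' Y Y' : C} (c : X' ⟶ X) (a : Y ⟶ Y')
    (ξ : yonedaExt h X Y 1) : yonedaExt h X' Y' 1 :=
  letI := h.abelian
  haveI := HasExt.standard.{v, u} C
  ((Abelian.Ext.mk₀ c).comp (show Abelian.Ext.{max u v} X Y 1 from ξ) (zero_add 1)).comp
    (Abelian.Ext.mk₀ a) (add_zero 1)

/-- `0 ⟶ A ⟶ B ⟶ Z ⟶ 0` is a short exact sequence with class `ξ` in `Ext¹(Z, A)`. -/
def IsShortExactWithClass {C : Type u} [Category.{v} C] [Preadditive C]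
    (h : IsAbelianCategory C) {A B Z : C} (x : A ⟶ B) (y : B ⟶ Z) (ξ : yonedaExt h Z A 1) :
    Prop :=
  letI := h.abelian
  haveI := HasExt.standard.{v, u} C
  ∃ (w : x ≫ y = 0) (hE : (ShortComplex.mk x y w).ShortExact),
    hE.extClass = (show Abelian.Ext.{max u v} Z A 1 from ξ)

/-- An extriangulated category with higher extension groups: either it has enough projectives and
enough injectives, or it is an abelian category with its usual extriangulated structure
(`𝔼 = Ext¹`, and `𝔼`-triangles the short exact sequences with their classes), or it is a
triangulated category with its usual extriangulated structure (`𝔼(Z, A) = Hom(Z, A[1])`, and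
`𝔼`-triangles the distinguished triangles). -/
inductive HigherExtensions {C : Type u} [Category.{v} C] [Preadditive C]
    (S : Extriangulated.{w} C) : Type (max u v w)
  | enough (hP : S.EnoughProjectives) (hI : S.EnoughInjectives)
  | abelian (h : IsAbelianCategory C)
      (φ : ∀ Z A : C, S.Ext Z A ≃+ yonedaExt h Z A 1)
      (naturality : ∀ {Z Z' A A' : C} (c : Z' ⟶ Z) (a : A ⟶ A') (δ : S.Ext Z A),
        φ Z' A' (push S.E a (pull S.E c δ)) = yonedaExtMap h c a (φ Z A δ))
      (realizes_iff : ∀ {A B Z : C} (x : A ⟶ B) (y : B ⟶ Z) (δ : S.Ext Z A),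
        S.Realizes x y δ ↔ IsShortExactWithClass h x y (φ Z A δ))
  | triangulated [HasZeroObject C] [HasShift C ℤ] [∀ n : ℤ, (shiftFunctor C n).Additive]
      [Pretriangulated C] [IsTriangulated C]
      (φ : ∀ Z A : C, S.Ext Z A ≃+ (Z ⟶ A⟦(1 : ℤ)⟧))
      (naturality : ∀ {Z Z' A A' : C} (c : Z' ⟶ Z) (a : A ⟶ A') (δ : S.Ext Z A),
        φ Z' A' (push S.E a (pull S.E c δ)) = c ≫ φ Z A δ ≫ a⟦(1 : ℤ)⟧')
      (realizes_iff : ∀ {A B Z : C} (x : A ⟶ B) (y : B ⟶ Z) (δ : S.Ext Z A),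
        S.Realizes x y δ ↔
          Pretriangulated.Triangle.mk x y (φ Z A δ) ∈ Pretriangulated.distinguishedTriangles)

namespace HigherExtensions

variable {C : Type u} [Category.{v} C] [Preadditive C] {S : Extriangulated.{w} C}

/-- `H.extSucc k X Y` is the higher extension group `𝔼ᵏ⁺¹(X, Y)`, for `k ≥ 0`. -/
def extSucc : HigherExtensions S → ℕ → C → C → AddCommGrpCat.{max u v w}
  | enough _ hI, k, X, Y => AddCommGrpCat.of (ULift.{max u v} (S.Ext X (S.iterCosyzygy hI k Y)))
  | abelian h _ _ _, k, X, Y => AddCommGrpCat.of (ULift.{w} (yonedaExt h X Y (k + 1)))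
  | triangulated _ _ _, k, X, Y =>
      AddCommGrpCat.of (ULift.{max u w} (X ⟶ Y⟦((k + 1 : ℕ) : ℤ)⟧))

/-- The relative injective dimension `id_X(M) = min {m ≥ 0 | 𝔼^{≥ m+1}(X, M) = 0}`, which is
`∞` if there is no such `m`. -/
def idObj (H : HigherExtensions S) (X : ObjectProperty C) (M : C) : ℕ∞ :=
  sInf {d : ℕ∞ | ∃ m : ℕ, d = m ∧
    ∀ k : ℕ, m ≤ k → ∀ A : C, X A → ∀ ξ : H.extSucc k A M, ξ = 0}

/-- `id_X(Y) = sup {id_X(M) | M ∈ Y}`. -/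
def idClass (H : HigherExtensions S) (X Y : ObjectProperty C) : ℕ∞ :=
  sSup {d : ℕ∞ | ∃ M : C, Y M ∧ d = H.idObj X M}

/-- Left Frobenius pairs `(X, ω)`. -/
structure IsLeftFrobeniusPair (H : HigherExtensions S) (X ω : ObjectProperty C) : Prop where
  leftThick : S.IsLeftThick X
  summands : Extriangulated.ClosedUnderSummands ω
  injective : H.idClass X ω = 0
  cogenerator : S.IsCogenerator ω X

end HigherExtensions

/-! ### The extriangulated category `D` for a subcategory `D` closed under extensions -/

namespace Extriangulated

variable {C : Type u} [Category.{v} C] [Preadditive C]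

section Restrict

variable (S : Extriangulated.{w} C) (D : ObjectProperty C)

/-- The restriction `𝔼_D` of `𝔼` to `D`. -/
def restrictE : D.FullSubcategoryᵒᵖ ⥤ D.FullSubcategory ⥤ AddCommGrpCat.{w} :=
  D.ι.op ⋙ S.E ⋙ (Functor.whiskeringLeft _ _ _).obj D.ι

lemma isDirectSum_map {D : ObjectProperty C} {A A' : D.FullSubcategory} (b : BinaryBicone A A')
    (hb : IsDirectSum b) : IsDirectSum (D.ι.mapBinaryBicone b) := by
  have h := congrArg (fun f => f.hom) hb
  exact h

variable {D}

/-- The restriction `𝔰_D` of `𝔰` to `D`: the middle term of a sequence realizing an extension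
between objects of `D` lies in `D`, and the sequence is regarded as one in `D`. -/
def restrictS (hD : S.ClosedUnderExtensions D) {Z A : D.FullSubcategory}
    (δ : Extn (S.restrictE D) Z A) : SeqClass A Z :=
  let p : Seq A.obj Z.obj := (S.s (Z := Z.obj) (A := A.obj) δ).out
  have hp : S.s (Z := Z.obj) (A := A.obj) δ = seqClass p.x p.y := (Quotient.out_eq _).symm
  seqClass (B := ⟨p.mid, hD p.x p.y ⟨δ, hp⟩ A.property Z.property⟩)
    (ObjectProperty.homMk p.x) (ObjectProperty.homMk p.y)

lemma restrictS_eq_iff (hD : S.ClosedUnderExtensions D) {A B Z : D.FullSubcategory}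
    (x : A ⟶ B) (y : B ⟶ Z) (δ : Extn (S.restrictE D) Z A) :
    S.restrictS hD δ = seqClass x y ↔
      S.s (Z := Z.obj) (A := A.obj) δ = seqClass x.hom y.hom := by
  have hp : S.s (Z := Z.obj) (A := A.obj) δ =
      seqClass (S.s (Z := Z.obj) (A := A.obj) δ).out.x (S.s (Z := Z.obj) (A := A.obj) δ).out.y :=
    (Quotient.out_eq _).symm
  rw [hp]
  unfold restrictS
  rw [seqClass_eq_iff, seqClass_eq_iff]
  constructor
  · rintro ⟨b, h₁, h₂⟩
    exact ⟨D.ι.mapIso b, congrArg (fun f => f.hom) h₁, congrArg (fun f => f.hom) h₂⟩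
  · rintro ⟨b, h₁, h₂⟩
    exact ⟨D.isoMk b, ObjectProperty.hom_ext _ h₁, ObjectProperty.hom_ext _ h₂⟩

lemma prop_of_isDirectSum (hD : S.ClosedUnderExtensions D) {A A' : C} (b : BinaryBicone A A')
    (hb : IsDirectSum b) (hA : D A) (hA' : D A') : D b.pt :=
  hD b.inl b.snd ⟨0, S.s_zero b hb⟩ hA hA'

/-- The extriangulated category `(D, 𝔼_D, 𝔰_D)`, for a full subcategory `D` which contains a zero
object and is closed under extensions. -/
def restrict (h0 : HasZero D) (hD : S.ClosedUnderExtensions D) :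
    Extriangulated.{w} D.FullSubcategory where
  hasZeroObject := by
    obtain ⟨Z, hZ, hDZ⟩ := h0
    refine ⟨⟨⟨Z, hDZ⟩, ?_, ?_⟩⟩
    · exact fun Y => ⟨⟨⟨ObjectProperty.homMk (hZ.to_ Y.obj)⟩,
        fun f => ObjectProperty.hom_ext _ (hZ.eq_of_src _ _)⟩⟩
    · exact fun Y => ⟨⟨⟨ObjectProperty.homMk (hZ.from_ Y.obj)⟩,
        fun f => ObjectProperty.hom_ext _ (hZ.eq_of_tgt _ _)⟩⟩
  hasBinaryBiproducts := by
    have := S.hasBinaryBiproducts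
    refine ⟨fun A A' => ?_⟩
    have hb : IsDirectSum (BinaryBiproduct.bicone A.obj A'.obj) :=
      IsBilimit.binary_total (BinaryBiproduct.isBilimit A.obj A'.obj)
    exact hasBinaryBiproduct_of_total
      { pt := ⟨_, S.prop_of_isDirectSum hD _ hb A.property A'.property⟩
        fst := ObjectProperty.homMk biprod.fst
        snd := ObjectProperty.homMk biprod.snd
        inl := ObjectProperty.homMk biprod.inl
        inr := ObjectProperty.homMk biprod.inr
        inl_fst := ObjectProperty.hom_ext _ biprod.inl_fst
        inl_snd := ObjectProperty.hom_ext _ biprod.inl_snd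
        inr_fst := ObjectProperty.hom_ext _ biprod.inr_fst
        inr_snd := ObjectProperty.hom_ext _ biprod.inr_snd }
      (ObjectProperty.hom_ext _ hb)
  E := S.restrictE D
  additive_left := by
    have := S.additive_left
    refine ⟨fun {Z Z'} {f g} => ?_⟩
    ext A : 2
    exact congrArg (fun t => t.app A.obj) (S.E.map_add (f := f.unop.hom.op) (g := g.unop.hom.op))
  additive_right := fun Z => by
    have := S.additive_right Z.obj
    exact ⟨fun {A A'} {f g} => (S.E.obj (op Z.obj)).map_add (f := f.hom) (g := g.hom)⟩
  s := S.restrictS hD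
  realization := by
    intro A B Z A' B' Z' x y x' y' δ δ' h h' a c hac
    rw [restrictS_eq_iff] at h h'
    obtain ⟨b, h₁, h₂⟩ := S.realization _ _ _ _ _ _ h h' a.hom c.hom hac
    exact ⟨ObjectProperty.homMk b, ObjectProperty.hom_ext _ h₁, ObjectProperty.hom_ext _ h₂⟩
  s_zero := by
    intro A Z b hb
    rw [restrictS_eq_iff]
    exact S.s_zero (D.ι.mapBinaryBicone b) (isDirectSum_map b hb)
  s_sum := by
    intro A B Z A' B' Z' x y x' y' δ δ' h h' bA bB bZ hA hB hZ
    rw [restrictS_eq_iff] at h h'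
    rw [restrictS_eq_iff]
    exact S.s_sum _ _ _ _ _ _ h h' (D.ι.mapBinaryBicone bA) (D.ι.mapBinaryBicone bB)
      (D.ι.mapBinaryBicone bZ) (isDirectSum_map bA hA) (isDirectSum_map bB hB)
      (isDirectSum_map bZ hZ)
  et3 := by
    intro A B Z A' B' Z' x y x' y' δ δ' h h' a b hab
    rw [restrictS_eq_iff] at h h'
    obtain ⟨c, h₁, h₂⟩ := S.et3 _ _ _ _ _ _ h h' a.hom b.hom (congrArg (fun f => f.hom) hab)
    exact ⟨ObjectProperty.homMk c, ObjectProperty.hom_ext _ h₁, h₂⟩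
  et3_op := by
    intro A B Z A' B' Z' x y x' y' δ δ' h h' b c hbc
    rw [restrictS_eq_iff] at h h'
    obtain ⟨a, h₁, h₂⟩ := S.et3_op _ _ _ _ _ _ h h' b.hom c.hom (congrArg (fun f => f.hom) hbc)
    exact ⟨ObjectProperty.homMk a, ObjectProperty.hom_ext _ h₁, h₂⟩
  et4 := by
    intro A B K M F f f' g g' δ δ' h h'
    rw [restrictS_eq_iff] at h h'
    obtain ⟨L, d, e, k, k', δ'', h₁, h₂, h₃, h₄, h₅, h₆, h₇⟩ := S.et4 _ _ _ _ _ _ h h'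
    refine ⟨⟨L, hD d e ⟨_, h₅⟩ K.property F.property⟩, ObjectProperty.homMk d,
      ObjectProperty.homMk e, ObjectProperty.homMk k, ObjectProperty.homMk k', δ'',
      ObjectProperty.hom_ext _ h₁, ObjectProperty.hom_ext _ h₂, ObjectProperty.hom_ext _ h₃,
      ?_, ?_, h₆, h₇⟩
    · exact (S.restrictS_eq_iff hD _ _ _).mpr h₄
    · exact (S.restrictS_eq_iff hD _ _ _).mpr h₅
  et4_op := by
    intro K A B F Z f' f g' g δ δ' h h'
    rw [restrictS_eq_iff] at h h'
    obtain ⟨L, d, e, k', k, δ'', h₁, h₂, h₃, h₄, h₅, h₆, h₇⟩ := S.et4_op _ _ _ _ _ _ h h'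
    refine ⟨⟨L, hD d e ⟨_, h₅⟩ K.property F.property⟩, ObjectProperty.homMk d,
      ObjectProperty.homMk e, ObjectProperty.homMk k', ObjectProperty.homMk k, δ'',
      ObjectProperty.hom_ext _ h₁, ObjectProperty.hom_ext _ h₂, ObjectProperty.hom_ext _ h₃,
      ?_, ?_, h₆, h₇⟩
    · exact (S.restrictS_eq_iff hD _ _ _).mpr h₄
    · exact (S.restrictS_eq_iff hD _ _ _).mpr h₅

end Restrict

section Thick

variable (S : Extriangulated.{w} C) (X : ObjectProperty C)

lemma hasZero_thick : HasZero (S.thick X) := by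
  have := S.hasZeroObject
  obtain ⟨Z, hZ⟩ := HasZeroObject.zero (C := C)
  refine ⟨Z, hZ, fun T hT _ => ?_⟩
  obtain ⟨Z', hZ', hTZ'⟩ := hT.1.hasZero
  exact (hT.1.summands
    { pt := Z', fst := 0, snd := 0, inl := 0, inr := 0
      inl_fst := hZ.eq_of_src _ _, inl_snd := hZ.eq_of_src _ _
      inr_fst := hZ.eq_of_src _ _, inr_snd := hZ.eq_of_src _ _ : BinaryBicone Z Z }
    (hZ'.eq_of_src _ _) hTZ').1

lemma closedUnderExtensions_thick : S.ClosedUnderExtensions (S.thick X) :=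
  fun _ _ _ x y h hA hZ T hT hXT => hT.1.extensions x y h (hA T hT hXT) (hZ T hT hXT)

/-- The extriangulated category `Thick(X)`. -/
def thickCategory : Extriangulated.{w} (S.thick X).FullSubcategory :=
  S.restrict (S.hasZero_thick X) (S.closedUnderExtensions_thick X)

end Thick

/-- `(F, G)` is a cotorsion pair in the extriangulated category `Thick(F)`: the classes `F` and `G`
of objects of `C` are contained in `Thick(F)` (this is automatic for `F`), and, as classes of
objects of `Thick(F)`, they form a cotorsion pair. -/
structure IsCotorsionPairInThick (S : Extriangulated.{w} C) (F G : ObjectProperty C) : Prop where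
  left_le : F ≤ S.thick F
  right_le : G ≤ S.thick F
  isCotorsionPair : (S.thickCategory F).IsCotorsionPair
    (F.inverseImage (S.thick F).ι) (G.inverseImage (S.thick F).ι)

end Extriangulated

end Extri

end

/-! This is Auslander–Buchweitz approximation theory in an extriangulated category.

Let `(X, ω)` be a left Frobenius pair. Dimension shifting along an `ω`-resolution gives `𝔼ᵏ(A, G) =
0` for all `k ≥ 1`, `A ∈ X` and `G ∈ ω^∧` (`vanishes_of_wedge`). Pushouts and the cogenerator `ω`
turn a finite `X`-resolution of `M` into conflations `G ⟶ F ⟶ M` and `M ⟶ G' ⟶ F'` with `F, F' ∈ X`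
and `G, G' ∈ ω^∧` (`exists_left_approximation`, `exists_right_approximation`). With these
approximations `X^∧` is seen to be thick (`isThick_wedge`), hence equal to `Thick(X)`, and the
approximations become the completeness of the pair `(X, ω^∧)` in `Thick(X)`. Moreover `ω` and `ω^∧`
consist of the objects `M` of `X` and of `X^∧`, respectively, with `𝔼(X, M) = 0` (`mem_iff`,
`wedge_iff`). This gives closure of `ω^∧` under summands and `X ∩ ω^∧ = ω`.

Conversely, in a cotorsion pair `(F, G)` in `Thick(F)` each class is the `𝔼`-orthogonal of the other
within `Thick(F)` (`left_iff`, `right_iff`). So `F` is closed under extensions, and the vanishing of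
`𝔼²(F, G)` makes it closed under cocones. The conflation `M ⟶ B ⟶ A` given by completeness for `M ∈
F` shows that `F ∩ G` is a cogenerator. Finally `(F ∩ G)^∧` and `G` are both the right orthogonal of
`F` in `Thick(F) = F^∧`, so they agree.

The three kinds of higher extensions enter only through a few facts about the vanishing of `𝔼ᵏ`: its
meaning in degree one, dimension shifting, and two pieces of the long exact sequences reaching `𝔼²`.
-/

namespace Extri

/-! ### Bifunctoriality of `𝔼` -/

section Functoriality

variable {C : Type u} [Category.{v} C] (E : Cᵒᵖ ⥤ C ⥤ AddCommGrpCat.{w})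

@[simp] lemma push_zero {Z A A' : C} (a : A ⟶ A') : push E a (0 : Extn E Z A) = 0 :=
  map_zero _

@[simp] lemma pull_zero {Z Z' A : C} (c : Z' ⟶ Z) : pull E c (0 : Extn E Z A) = 0 :=
  map_zero _

lemma push_add {Z A A' : C} (a : A ⟶ A') (δ δ' : Extn E Z A) :
    push E a (δ + δ') = push E a δ + push E a δ' :=
  map_add _ _ _

lemma pull_add {Z Z' A : C} (c : Z' ⟶ Z) (δ δ' : Extn E Z A) :
    pull E c (δ + δ') = pull E c δ + pull E c δ' :=
  map_add _ _ _

@[simp] lemma push_id {Z A : C} (δ : Extn E Z A) : push E (𝟙 A) δ = δ := by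
  simp [push]

@[simp] lemma pull_id {Z A : C} (δ : Extn E Z A) : pull E (𝟙 Z) δ = δ := by
  simp [pull]

lemma push_comp {Z A A' A'' : C} (a : A ⟶ A') (a' : A' ⟶ A'') (δ : Extn E Z A) :
    push E (a ≫ a') δ = push E a' (push E a δ) := by
  simp [push]

lemma pull_comp {Z Z' Z'' A : C} (c : Z' ⟶ Z) (c' : Z'' ⟶ Z') (δ : Extn E Z A) :
    pull E (c' ≫ c) δ = pull E c' (pull E c δ) := by
  simp [pull]

lemma push_pull {Z Z' A A' : C} (a : A ⟶ A') (c : Z' ⟶ Z) (δ : Extn E Z A) :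
    push E a (pull E c δ) = pull E c (push E a δ) :=
  (ConcreteCategory.congr_hom ((E.map c.op).naturality a) δ).symm

end Functoriality

namespace Extriangulated

variable {C : Type u} [Category.{v} C] [Preadditive C] (S : Extriangulated.{w} C)

@[simp] lemma push_zero_hom {Z A A' : C} (δ : S.Ext Z A) : push S.E (0 : A ⟶ A') δ = 0 := by
  have := S.additive_right Z
  simp [push]

@[simp] lemma pull_zero_hom {Z Z' A : C} (δ : S.Ext Z A) : pull S.E (0 : Z' ⟶ Z) δ = 0 := by
  have := S.additive_left
  simp [pull]

/-- The biproduct decomposition of `A` as `A ⊕ 0`. -/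
def biconeZeroRight (A : C) {O : C} (hO : IsZero O) : BinaryBicone A O where
  pt := A
  fst := 𝟙 A
  snd := 0
  inl := 𝟙 A
  inr := 0
  inr_snd := hO.eq_of_src _ _

lemma isDirectSum_biconeZeroRight (A : C) {O : C} (hO : IsZero O) :
    IsDirectSum (biconeZeroRight A hO) := by
  change 𝟙 A ≫ 𝟙 A + (0 : A ⟶ O) ≫ (0 : O ⟶ A) = 𝟙 A
  simp

/-- The biproduct decomposition of `A` as `0 ⊕ A`. -/
def biconeZeroLeft (A : C) {O : C} (hO : IsZero O) : BinaryBicone O A where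
  pt := A
  fst := 0
  snd := 𝟙 A
  inl := 0
  inr := 𝟙 A
  inl_fst := hO.eq_of_src _ _

lemma isDirectSum_biconeZeroLeft (A : C) {O : C} (hO : IsZero O) :
    IsDirectSum (biconeZeroLeft A hO) := by
  change (0 : A ⟶ O) ≫ (0 : O ⟶ A) + 𝟙 A ≫ 𝟙 A = 𝟙 A
  simp

lemma exists_isZero (S : Extriangulated.{w} C) : ∃ O : C, IsZero O := S.hasZeroObject.zero

lemma exists_isDirectSum (S : Extriangulated.{w} C) (A B : C) : ∃ b : BinaryBicone A B, IsDirectSum b := by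
  have := S.hasBinaryBiproducts
  exact ⟨BinaryBiproduct.bicone A B, IsBilimit.binary_total (BinaryBiproduct.isBilimit A B)⟩

/-- The trivial conflations `A = A ⟶ 0` and `0 ⟶ A = A` are test objects: comparing an arbitrary
conflation with them through (ET3) and its dual produces the first exactness statements. -/
lemma realizes_id_zero (A : C) {O : C} (hO : IsZero O) :
    S.Realizes (𝟙 A) (0 : A ⟶ O) (0 : S.Ext O A) :=
  S.s_zero _ (isDirectSum_biconeZeroRight A hO)

lemma realizes_zero_id (A : C) {O : C} (hO : IsZero O) :
    S.Realizes (0 : O ⟶ A) (𝟙 A) (0 : S.Ext A O) :=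
  S.s_zero _ (isDirectSum_biconeZeroLeft A hO)

lemma exists_realizes {Z A : C} (δ : S.Ext Z A) :
    ∃ (B : C) (x : A ⟶ B) (y : B ⟶ Z), S.Realizes x y δ :=
  exists_seqClass _

/-! ### The exact sequences of a conflation -/

section Exactness

variable {S} {A B Z : C} {x : A ⟶ B} {y : B ⟶ Z} {δ : S.Ext Z A}

lemma Realizes.push_eq_zero (h : S.Realizes x y δ) : push S.E x δ = 0 := by
  obtain ⟨O, hO⟩ := S.exists_isZero
  obtain ⟨c, _, hc⟩ := S.et3 _ _ _ _ _ _ h (S.realizes_id_zero B hO) x (𝟙 B) rfl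
  rw [hc, pull_zero]

lemma Realizes.pull_eq_zero (h : S.Realizes x y δ) : pull S.E y δ = 0 := by
  obtain ⟨O, hO⟩ := S.exists_isZero
  obtain ⟨a, _, ha⟩ := S.et3_op _ _ _ _ _ _ (S.realizes_zero_id B hO) h (𝟙 B) y rfl
  rw [← ha, push_zero]

/-- Exactness of `Hom(Z, M) ⟶ Hom(B, M) ⟶ Hom(A, M)`. -/
lemma Realizes.exists_desc (h : S.Realizes x y δ) {M : C} (f : B ⟶ M) (hf : x ≫ f = 0) :
    ∃ g : Z ⟶ M, y ≫ g = f := by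
  obtain ⟨O, hO⟩ := S.exists_isZero
  obtain ⟨g, hg, _⟩ := S.et3 _ _ _ _ _ _ h (S.realizes_zero_id M hO) 0 f (by simp [hf])
  exact ⟨g, by simpa using hg⟩

/-- Exactness of `Hom(M, A) ⟶ Hom(M, B) ⟶ Hom(M, Z)`. -/
lemma Realizes.exists_lift (h : S.Realizes x y δ) {M : C} (f : M ⟶ B) (hf : f ≫ y = 0) :
    ∃ g : M ⟶ A, g ≫ x = f := by
  obtain ⟨O, hO⟩ := S.exists_isZero
  obtain ⟨g, hg, _⟩ := S.et3_op _ _ _ _ _ _ (S.realizes_id_zero M hO) h f 0 (by simp [hf])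
  exact ⟨g, by simpa using hg.symm⟩

/-- Exactness of `Hom(B, M) ⟶ Hom(A, M) ⟶ 𝔼(Z, M)`. -/
lemma Realizes.exists_extend (h : S.Realizes x y δ) {M : C} (f : A ⟶ M)
    (hf : push S.E f δ = 0) : ∃ g : B ⟶ M, x ≫ g = f := by
  obtain ⟨b, hb⟩ := S.exists_isDirectSum M Z
  obtain ⟨g, hg, _⟩ := S.realization _ _ _ _ _ _ h (S.s_zero b hb) f (𝟙 Z) (by simp [hf])
  exact ⟨g ≫ b.fst, by rw [← Category.assoc, hg, Category.assoc, b.inl_fst, Category.comp_id]⟩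

/-- Exactness of `Hom(M, B) ⟶ Hom(M, Z) ⟶ 𝔼(M, A)`. -/
lemma Realizes.exists_lift_of_pull (h : S.Realizes x y δ) {M : C} (f : M ⟶ Z)
    (hf : pull S.E f δ = 0) : ∃ g : M ⟶ B, g ≫ y = f := by
  obtain ⟨b, hb⟩ := S.exists_isDirectSum A M
  obtain ⟨g, _, hg⟩ := S.realization _ _ _ _ _ _ (S.s_zero b hb) h (𝟙 A) f (by simp [hf])
  exact ⟨b.inr ≫ g, by rw [Category.assoc, ← hg, ← Category.assoc, b.inr_snd, Category.id_comp]⟩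

/-- Exactness of `Hom(A, M) ⟶ 𝔼(Z, M) ⟶ 𝔼(B, M)`. -/
lemma Realizes.exists_push_eq (h : S.Realizes x y δ) {M : C} (ε : S.Ext Z M)
    (hε : pull S.E y ε = 0) : ∃ f : A ⟶ M, push S.E f δ = ε := by
  obtain ⟨N, x', y', h'⟩ := S.exists_realizes ε
  obtain ⟨b, hb⟩ := h'.exists_lift_of_pull y hε
  obtain ⟨f, _, hf⟩ := S.et3_op _ _ _ _ _ _ h h' b (𝟙 Z) (by simp [hb])
  exact ⟨f, by simpa using hf⟩

/-- Exactness of `Hom(M, Z) ⟶ 𝔼(M, A) ⟶ 𝔼(M, B)`. -/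
lemma Realizes.exists_pull_eq (h : S.Realizes x y δ) {M : C} (ε : S.Ext M A)
    (hε : push S.E x ε = 0) : ∃ f : M ⟶ Z, pull S.E f δ = ε := by
  obtain ⟨N, x', y', h'⟩ := S.exists_realizes ε
  obtain ⟨b, hb⟩ := h'.exists_extend x hε
  obtain ⟨f, _, hf⟩ := S.et3 _ _ _ _ _ _ h' h (𝟙 A) b (by simp [hb])
  exact ⟨f, by simpa using hf.symm⟩

lemma Realizes.exists_retraction {x : A ⟶ B} {y : B ⟶ Z} (h : S.Realizes x y (0 : S.Ext Z A)) :
    ∃ r : B ⟶ A, x ≫ r = 𝟙 A :=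
  h.exists_extend (𝟙 A) (push_zero _ _)

lemma Realizes.exists_section {x : A ⟶ B} {y : B ⟶ Z} (h : S.Realizes x y (0 : S.Ext Z A)) :
    ∃ r : Z ⟶ B, r ≫ y = 𝟙 Z :=
  h.exists_lift_of_pull (𝟙 Z) (pull_zero _ _)

/-- Exactness of `𝔼(Z, M) ⟶ 𝔼(B, M) ⟶ 𝔼(A, M)`. -/
lemma Realizes.exists_pull_deflation_eq (h : S.Realizes x y δ) {M : C} (ε : S.Ext B M)
    (hε : pull S.E x ε = 0) : ∃ ζ : S.Ext Z M, pull S.E y ζ = ε := by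
  obtain ⟨N, x', y', h'⟩ := S.exists_realizes ε
  -- The kernel `K` of `N ⟶ B ⟶ Z` is an extension of `A` by `M` with class `pull S.E x ε = 0`. A
  -- retraction `K ⟶ M` therefore pushes `δ''` to the required class over `Z`.
  obtain ⟨K, d, e, _, _, δ'', _, _, _, _, hK, _, hd⟩ := S.et4_op _ _ _ _ _ _ h' h
  rw [hε] at hK
  obtain ⟨r, hr⟩ := Realizes.exists_retraction hK
  exact ⟨push S.E r δ'', by rw [← push_pull, ← hd, ← push_comp, hr, push_id]⟩

/-- Exactness of `𝔼(M, A) ⟶ 𝔼(M, B) ⟶ 𝔼(M, Z)`. -/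
lemma Realizes.exists_push_inflation_eq (h : S.Realizes x y δ) {M : C} (ε : S.Ext M B)
    (hε : push S.E y ε = 0) : ∃ ζ : S.Ext M A, push S.E x ζ = ε := by
  obtain ⟨N, x', y', h'⟩ := S.exists_realizes ε
  obtain ⟨K, d, e, _, _, δ'', _, _, _, _, hK, _, hd⟩ := S.et4 _ _ _ _ _ _ h h'
  rw [hε] at hK
  obtain ⟨r, hr⟩ := Realizes.exists_section hK
  exact ⟨pull S.E r δ'', by rw [push_pull, hd, ← pull_comp, hr, pull_id]⟩

/-- A conflation realizing `0` is a biproduct decomposition. -/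
lemma Realizes.exists_isDirectSum {x : A ⟶ B} {y : B ⟶ Z} (h : S.Realizes x y (0 : S.Ext Z A)) :
    ∃ b : BinaryBicone A Z, IsDirectSum b ∧ b.pt = B := by
  obtain ⟨b, hb⟩ := S.exists_isDirectSum A Z
  obtain ⟨i, _, _⟩ := (seqClass_eq_iff _ _ _ _).mp ((S.s_zero b hb).symm.trans h)
  refine ⟨{ pt := B, fst := i.inv ≫ b.fst, snd := i.inv ≫ b.snd,
            inl := b.inl ≫ i.hom, inr := b.inr ≫ i.hom }, ?_, rfl⟩
  have := congrArg (fun f => i.inv ≫ f ≫ i.hom) hb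
  simpa [IsDirectSum] using this

end Exactness

/-! ### Isomorphisms of conflations, pullbacks, pushouts and composites -/

section Constructions

variable {S}

/-- A morphism of conflations with identity first component and invertible third component is
invertible. -/
lemma isIso_of_morphism {A B Z B' Z' : C} {x : A ⟶ B} {y : B ⟶ Z} {δ : S.Ext Z A}
    {x' : A ⟶ B'} {y' : B' ⟶ Z'} {δ' : S.Ext Z' A} (h : S.Realizes x y δ)
    (h' : S.Realizes x' y' δ') (b : B ⟶ B') (j : Z ≅ Z') (hx : x ≫ b = x')
    (hy : y ≫ j.hom = b ≫ y') (hδ : δ = pull S.E j.hom δ') : IsIso b := by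
  -- Factorizations through a conflation exist but need not be unique, since inflations need not be
  -- monic nor deflations epic. So a right and a left inverse are built separately, each by
  -- correcting an approximate inverse with a map through an end term.
  have hs : ∃ r : B' ⟶ B, r ≫ b = 𝟙 B' := by
    obtain ⟨r, hr⟩ := h.exists_lift_of_pull (y' ≫ j.inv) (by
      rw [hδ, ← pull_comp, Category.assoc, j.inv_hom_id, Category.comp_id, h'.pull_eq_zero])
    obtain ⟨t, ht⟩ := h'.exists_lift (𝟙 B' - r ≫ b) (by
      rw [Preadditive.sub_comp, Category.assoc, ← hy, ← Category.assoc, hr]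
      simp)
    refine ⟨r + t ≫ x, ?_⟩
    rw [Preadditive.add_comp, Category.assoc, hx, ht, add_sub_cancel]
  have hr : ∃ r : B' ⟶ B, b ≫ r = 𝟙 B := by
    obtain ⟨r, hr⟩ := h'.exists_extend x (by
      have := congrArg (pull S.E j.inv) hδ
      rw [← pull_comp, j.inv_hom_id, pull_id] at this
      rw [← this, push_pull, h.push_eq_zero, pull_zero])
    obtain ⟨t, ht⟩ := h.exists_desc (𝟙 B - b ≫ r) (by
      rw [Preadditive.comp_sub, ← Category.assoc, hx, hr, Category.comp_id, sub_self])
    refine ⟨r + y' ≫ j.inv ≫ t, ?_⟩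
    rw [Preadditive.comp_add, ← Category.assoc b y', ← hy, Category.assoc, j.hom_inv_id_assoc, ht,
      add_sub_cancel]
  obtain ⟨r, hr⟩ := hr
  obtain ⟨s, hs⟩ := hs
  have : r = s := by
    rw [← Category.id_comp r, ← hs, Category.assoc, hr, Category.comp_id]
  exact ⟨r, hr, this ▸ hs⟩

/-- `S.s` identifies sequences only along isomorphisms of the middle term, with fixed ends. To move
an end one realizes the transported extension and compares it with the given one by
`isIso_of_morphism`. -/
lemma Realizes.comp_iso {A B Z Z' : C} {x : A ⟶ B} {y : B ⟶ Z} {δ : S.Ext Z A}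
    (h : S.Realizes x y δ) (j : Z ≅ Z') : S.Realizes x (y ≫ j.hom) (pull S.E j.inv δ) := by
  obtain ⟨N, x', y', h'⟩ := S.exists_realizes (pull S.E j.inv δ)
  have hδ : δ = pull S.E j.hom (pull S.E j.inv δ) := by
    rw [← pull_comp, j.hom_inv_id, pull_id]
  obtain ⟨b, hx, hy⟩ := S.realization _ _ _ _ _ _ h h' (𝟙 A) j.hom (by simpa using hδ)
  rw [Category.id_comp] at hx
  have := isIso_of_morphism h h' b j hx hy hδ
  refine h'.trans ((seqClass_eq_iff _ _ _ _).mpr ⟨(asIso b).symm, ?_, ?_⟩)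
  · simp [← hx]
  · simp [hy]

/-- A morphism of conflations with identity third component and invertible first component is
invertible. -/
lemma isIso_of_morphism' {A B Z A' B' : C} {x : A ⟶ B} {y : B ⟶ Z} {δ : S.Ext Z A}
    {x' : A' ⟶ B'} {y' : B' ⟶ Z} {δ' : S.Ext Z A'} (h : S.Realizes x y δ)
    (h' : S.Realizes x' y' δ') (b : B ⟶ B') (j : A ≅ A') (hx : x ≫ b = j.hom ≫ x')
    (hy : y = b ≫ y') (hδ : push S.E j.hom δ = δ') : IsIso b := by
  have hδ' : push S.E j.inv δ' = δ := by
    rw [← hδ, ← push_comp, j.hom_inv_id, push_id]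
  have hs : ∃ r : B' ⟶ B, r ≫ b = 𝟙 B' := by
    obtain ⟨r, hr⟩ := h.exists_lift_of_pull y' (by
      rw [← hδ', ← push_pull, h'.pull_eq_zero, push_zero])
    obtain ⟨t, ht⟩ := h'.exists_lift (𝟙 B' - r ≫ b) (by
      rw [Preadditive.sub_comp, Category.assoc, ← hy, hr, Category.id_comp, sub_self])
    refine ⟨r + t ≫ j.inv ≫ x, ?_⟩
    rw [Preadditive.add_comp, Category.assoc, Category.assoc, hx, j.inv_hom_id_assoc, ht,
      add_sub_cancel]
  have hr : ∃ r : B' ⟶ B, b ≫ r = 𝟙 B := by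
    obtain ⟨r, hr⟩ := h'.exists_extend (j.inv ≫ x) (by
      rw [push_comp, hδ', h.push_eq_zero])
    obtain ⟨t, ht⟩ := h.exists_desc (𝟙 B - b ≫ r) (by
      rw [Preadditive.comp_sub, ← Category.assoc, hx, Category.assoc, hr]
      simp)
    refine ⟨r + y' ≫ t, ?_⟩
    rw [Preadditive.comp_add, ← Category.assoc b y', ← hy, ht, add_sub_cancel]
  obtain ⟨r, hr⟩ := hr
  obtain ⟨s, hs⟩ := hs
  have : r = s := by
    rw [← Category.id_comp r, ← hs, Category.assoc, hr, Category.comp_id]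
  exact ⟨r, hr, this ▸ hs⟩

lemma Realizes.iso_comp {A A' B Z : C} {x : A ⟶ B} {y : B ⟶ Z} {δ : S.Ext Z A}
    (h : S.Realizes x y δ) (j : A ≅ A') : S.Realizes (j.inv ≫ x) y (push S.E j.hom δ) := by
  obtain ⟨N, x', y', h'⟩ := S.exists_realizes (push S.E j.hom δ)
  obtain ⟨b, hx, hy⟩ := S.realization _ _ _ _ _ _ h h' j.hom (𝟙 Z) (by simp)
  rw [Category.comp_id] at hy
  have := isIso_of_morphism' h h' b j hx hy rfl
  refine h'.trans ((seqClass_eq_iff _ _ _ _).mpr ⟨(asIso b).symm, ?_, ?_⟩)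
  · rw [← cancel_mono b]
    simp [hx]
  · simp [hy]

/-- If `δ ∈ 𝔼(F, G)` lifts along a deflation `W ⟶ G` with kernel `K`, then the conflation
`G ⟶ P ⟶ F` realizing `δ` lifts to a conflation `W ⟶ Q ⟶ F`, with a conflation `K ⟶ Q ⟶ P`. -/
lemma exists_lift_conflation {K W G P F : C} {k : K ⟶ W} {y : W ⟶ G} (h : S.IsConflation k y)
    {i : G ⟶ P} {p : P ⟶ F} {δ : S.Ext F G} (hP : S.Realizes i p δ) {δ' : S.Ext F W}
    (hδ : push S.E y δ' = δ) :
    ∃ (Q : C) (i' : W ⟶ Q) (p' : Q ⟶ F) (k' : K ⟶ Q) (q : Q ⟶ P),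
      S.IsConflation i' p' ∧ S.IsConflation k' q := by
  obtain ⟨ε, h⟩ := h
  obtain ⟨Q, i', p', hQ⟩ := S.exists_realizes δ'
  obtain ⟨N, d, e, f, f', δ'', _, _, _, hf, hN, _, _⟩ := S.et4 _ _ _ _ _ _ h hQ
  rw [hδ] at hN
  obtain ⟨j, _, _⟩ := (seqClass_eq_iff _ _ _ _).mp (hN.symm.trans hP)
  exact ⟨Q, i', p', f, f' ≫ j.hom, ⟨_, hQ⟩, _, Realizes.comp_iso hf j⟩

/-- Two conflations with the same third term have a common pullback. -/
lemma exists_pullback {A₁ B₁ A₂ B₂ Z : C} {x₁ : A₁ ⟶ B₁} {y₁ : B₁ ⟶ Z} {x₂ : A₂ ⟶ B₂}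
    {y₂ : B₂ ⟶ Z} (h₁ : S.IsConflation x₁ y₁) (h₂ : S.IsConflation x₂ y₂) :
    ∃ (P : C) (f₁ : A₁ ⟶ P) (g₂ : P ⟶ B₂) (f₂ : A₂ ⟶ P) (g₁ : P ⟶ B₁),
      S.IsConflation f₁ g₂ ∧ S.IsConflation f₂ g₁ := by
  obtain ⟨δ₁, h₁⟩ := h₁
  obtain ⟨δ₂, h₂⟩ := h₂
  -- `P` realizes the extension `(δ₁, δ₂)` of `Z` by `A₁ ⊕ A₂`. By (ET4) its quotient by `A₁`
  -- realizes the pushforward along the second projection, which is `δ₂`, and so is `B₂`. The other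
  -- conflation follows by exchanging the summands.
  have key : ∀ {A₁ A₂ B₂ : C} (δ₁ : S.Ext Z A₁) (δ₂ : S.Ext Z A₂) {x₂ : A₂ ⟶ B₂} {y₂ : B₂ ⟶ Z}
      (_ : S.Realizes x₂ y₂ δ₂) (b : BinaryBicone A₁ A₂) (_ : IsDirectSum b) {P : C}
      (i : b.pt ⟶ P) (p : P ⟶ Z)
      (_ : S.Realizes i p (push S.E b.inl δ₁ + push S.E b.inr δ₂)),
      ∃ (f₁ : A₁ ⟶ P) (g₂ : P ⟶ B₂), S.IsConflation f₁ g₂ := by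
    intro A₁ A₂ B₂ δ₁ δ₂ x₂ y₂ h₂ b hb P i p hP
    obtain ⟨K, d, e, f, f', δ'', _, _, _, hf, hK, _, _⟩ :=
      S.et4 _ _ _ _ _ _ (S.s_zero b hb) hP
    rw [push_add, ← push_comp, ← push_comp, b.inl_snd, b.inr_snd, push_id, push_zero_hom,
      zero_add] at hK
    obtain ⟨j, _, _⟩ := (seqClass_eq_iff _ _ _ _).mp (hK.symm.trans h₂)
    exact ⟨f, f' ≫ j.hom, _, Realizes.comp_iso hf j⟩
  obtain ⟨b, hb⟩ := S.exists_isDirectSum A₁ A₂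
  obtain ⟨P, i, p, hP⟩ := S.exists_realizes (push S.E b.inl δ₁ + push S.E b.inr δ₂)
  obtain ⟨f₁, g₂, h⟩ := key δ₁ δ₂ h₂ b hb i p hP
  let b' : BinaryBicone A₂ A₁ :=
    { pt := b.pt, fst := b.snd, snd := b.fst, inl := b.inr, inr := b.inl }
  obtain ⟨f₂, g₁, h'⟩ := key δ₂ δ₁ h₁ b' (by simpa [IsDirectSum, b', add_comm] using hb) i p
    (by simpa [b', add_comm] using hP)
  exact ⟨P, f₁, g₂, f₂, g₁, h, h'⟩

/-- Two conflations with the same first term have a common pushout. -/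
lemma exists_pushout {A B₁ Z₁ B₂ Z₂ : C} {x₁ : A ⟶ B₁} {y₁ : B₁ ⟶ Z₁} {x₂ : A ⟶ B₂}
    {y₂ : B₂ ⟶ Z₂} (h₁ : S.IsConflation x₁ y₁) (h₂ : S.IsConflation x₂ y₂) :
    ∃ (P : C) (f₁ : B₁ ⟶ P) (g₂ : P ⟶ Z₂) (f₂ : B₂ ⟶ P) (g₁ : P ⟶ Z₁),
      S.IsConflation f₁ g₂ ∧ S.IsConflation f₂ g₁ := by
  obtain ⟨δ₁, h₁⟩ := h₁
  obtain ⟨δ₂, h₂⟩ := h₂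
  -- Dually, `P` realizes the extension `(δ₁, δ₂)` of `Z₁ ⊕ Z₂` by `A`, and its restriction to `Z₁`
  -- is `δ₁`, realized by `B₁`.
  have key : ∀ {Z₁ Z₂ B₁ : C} (δ₁ : S.Ext Z₁ A) (δ₂ : S.Ext Z₂ A) {x₁ : A ⟶ B₁} {y₁ : B₁ ⟶ Z₁}
      (_ : S.Realizes x₁ y₁ δ₁) (b : BinaryBicone Z₁ Z₂) (_ : IsDirectSum b) {P : C}
      (i : A ⟶ P) (p : P ⟶ b.pt)
      (_ : S.Realizes i p (pull S.E b.fst δ₁ + pull S.E b.snd δ₂)),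
      ∃ (f₁ : B₁ ⟶ P) (g₂ : P ⟶ Z₂), S.IsConflation f₁ g₂ := by
    intro Z₁ Z₂ B₁ δ₁ δ₂ x₁ y₁ h₁ b hb P i p hP
    obtain ⟨K, d, e, f, f', δ'', _, _, _, hf, hK, _, _⟩ :=
      S.et4_op _ _ _ _ _ _ hP (S.s_zero b hb)
    rw [pull_add, ← pull_comp, ← pull_comp, b.inl_fst, b.inl_snd, pull_id, pull_zero_hom,
      add_zero] at hK
    obtain ⟨j, _, _⟩ := (seqClass_eq_iff _ _ _ _).mp (hK.symm.trans h₁)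
    exact ⟨j.inv ≫ f, f', _, Realizes.iso_comp hf j⟩
  obtain ⟨b, hb⟩ := S.exists_isDirectSum Z₁ Z₂
  obtain ⟨P, i, p, hP⟩ := S.exists_realizes (pull S.E b.fst δ₁ + pull S.E b.snd δ₂)
  obtain ⟨f₁, g₂, h⟩ := key δ₁ δ₂ h₁ b hb i p hP
  let b' : BinaryBicone Z₂ Z₁ :=
    { pt := b.pt, fst := b.snd, snd := b.fst, inl := b.inr, inr := b.inl }
  obtain ⟨f₂, g₁, h'⟩ := key δ₂ δ₁ h₂ b' (by simpa [IsDirectSum, b', add_comm] using hb) i p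
    (by simpa [b', add_comm] using hP)
  exact ⟨P, f₁, g₂, f₂, g₁, h, h'⟩

/-- The composite of two deflations is a deflation, and the kernels form a conflation. -/
lemma IsConflation.comp_deflation {D A B F Z : C} {f' : D ⟶ A} {f : A ⟶ B} {g' : F ⟶ B}
    {g : B ⟶ Z} (h₁ : S.IsConflation f' f) (h₂ : S.IsConflation g' g) :
    ∃ (K : C) (k : K ⟶ A) (d : D ⟶ K) (e : K ⟶ F),
      S.IsConflation k (f ≫ g) ∧ S.IsConflation d e := by
  obtain ⟨δ₁, h₁⟩ := h₁
  obtain ⟨δ₂, h₂⟩ := h₂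
  obtain ⟨K, d, e, k, _, δ'', _, _, rfl, hk, hd, _, _⟩ := S.et4_op _ _ _ _ _ _ h₁ h₂
  exact ⟨K, k, d, e, ⟨_, hk⟩, _, hd⟩

/-- The composite of two inflations is an inflation, and the cokernels form a conflation. -/
lemma IsConflation.comp_inflation {A B D M F : C} {f : A ⟶ B} {f' : B ⟶ D} {g : B ⟶ M}
    {g' : M ⟶ F} (h₁ : S.IsConflation f f') (h₂ : S.IsConflation g g') :
    ∃ (K : C) (k : M ⟶ K) (d : D ⟶ K) (e : K ⟶ F),
      S.IsConflation (f ≫ g) k ∧ S.IsConflation d e := by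
  obtain ⟨δ₁, h₁⟩ := h₁
  obtain ⟨δ₂, h₂⟩ := h₂
  obtain ⟨K, d, e, _, k, δ'', rfl, _, _, hk, hd, _, _⟩ := S.et4 _ _ _ _ _ _ h₁ h₂
  exact ⟨K, k, d, e, ⟨_, hk⟩, _, hd⟩

lemma isConflation_zero_id (A : C) {O : C} (hO : IsZero O) :
    S.IsConflation (0 : O ⟶ A) (𝟙 A) :=
  ⟨_, S.realizes_zero_id A hO⟩

end Constructions

end Extriangulated
end Extri

namespace Extri

namespace Extriangulated

variable {C : Type u} [Category.{v} C] [Preadditive C] {S : Extriangulated.{w} C}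

/-! ### Dimension shifting with enough projectives and injectives -/

section EnoughProjectives

lemma IsProjective.ext_eq_zero {P M : C} (hP : S.IsProjective P) (δ : S.Ext P M) : δ = 0 := by
  obtain ⟨B, x, y, h⟩ := S.exists_realizes δ
  obtain ⟨s, hs⟩ := hP x y ⟨δ, h⟩ (𝟙 P)
  rw [← pull_id S.E δ, ← hs, pull_comp, h.pull_eq_zero, pull_zero]

lemma IsInjective.ext_eq_zero {I M : C} (hI : S.IsInjective I) (δ : S.Ext M I) : δ = 0 := by
  obtain ⟨B, x, y, h⟩ := S.exists_realizes δ
  obtain ⟨s, hs⟩ := hI x y ⟨δ, h⟩ (𝟙 I)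
  rw [← push_id S.E δ, ← hs, push_comp, h.push_eq_zero, push_zero]

/-- A syzygy of `M`: the first term of a chosen conflation `ΩM ⟶ P ⟶ M` with `P` projective. -/
noncomputable def syzygy (h : S.EnoughProjectives) (M : C) : C := (h M).choose

lemma exists_syzygy_realizes (h : S.EnoughProjectives) (M : C) :
    ∃ (P : C) (x : S.syzygy h M ⟶ P) (y : P ⟶ M) (δ : S.Ext M (S.syzygy h M)),
      S.IsProjective P ∧ S.Realizes x y δ := by
  obtain ⟨P, x, y, hP, δ, hδ⟩ := (h M).choose_spec
  exact ⟨P, x, y, δ, hP, hδ⟩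

lemma exists_cosyzygy_realizes (h : S.EnoughInjectives) (M : C) :
    ∃ (I : C) (x : M ⟶ I) (y : I ⟶ S.cosyzygy h M) (δ : S.Ext (S.cosyzygy h M) M),
      S.IsInjective I ∧ S.Realizes x y δ := by
  obtain ⟨I, x, y, hI, δ, hδ⟩ := (h M).choose_spec
  exact ⟨I, x, y, δ, hI, hδ⟩

/-- Since `𝔼(P, -)` and `𝔼(-, I)` vanish, classes on either side come from morphisms `ΩX ⟶ ΣM`, and
vanishing of one group lets such a morphism factor through the projective, or through the injective,
which kills the other group. -/
lemma ext_cosyzygy_eq_zero_iff (hP : S.EnoughProjectives) (hI : S.EnoughInjectives) (X M : C) :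
    (∀ ξ : S.Ext X (S.cosyzygy hI M), ξ = 0) ↔ ∀ ξ : S.Ext (S.syzygy hP X) M, ξ = 0 := by
  obtain ⟨P, i, p, δ, hPP, hδ⟩ := exists_syzygy_realizes hP X
  obtain ⟨I, j, q, δ', hII, hδ'⟩ := exists_cosyzygy_realizes hI M
  constructor
  · intro H ξ
    obtain ⟨f, rfl⟩ := hδ'.exists_pull_eq ξ (hII.ext_eq_zero _)
    obtain ⟨g, rfl⟩ := hδ.exists_extend f (H _)
    rw [pull_comp, hPP.ext_eq_zero (pull S.E g δ'), pull_zero]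
  · intro H ξ
    obtain ⟨f, rfl⟩ := hδ.exists_push_eq ξ (hPP.ext_eq_zero _)
    obtain ⟨g, rfl⟩ := hδ'.exists_lift_of_pull f (H _)
    rw [push_comp, hII.ext_eq_zero (push S.E g δ), push_zero]

/-- Moves the shift to the first variable, so that the second one can vary in a conflation without
choosing compatible cosyzygies. -/
lemma ext_iterCosyzygy_eq_zero_iff (hP : S.EnoughProjectives) (hI : S.EnoughInjectives) (k : ℕ)
    (X M : C) : (∀ ξ : S.Ext X (S.iterCosyzygy hI k M), ξ = 0) ↔
      ∀ ξ : S.Ext ((S.syzygy hP)^[k] X) M, ξ = 0 := by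
  induction k generalizing X with
  | zero => exact Iff.rfl
  | succ k ih => exact (ext_cosyzygy_eq_zero_iff hP hI _ _).trans (ih _)

/-- A class in `𝔼(X, Z)` is the pushforward of the syzygy extension along some `ΩX ⟶ Z`, and the
obstruction to lifting this morphism to `B` lies in `𝔼(ΩX, A)`. -/
lemma exists_push_deflation_eq_of_syzygy (hP : S.EnoughProjectives) {A B Z : C} {x : A ⟶ B}
    {y : B ⟶ Z} (h : S.IsConflation x y) {X : C}
    (H : ∀ ξ : S.Ext (S.syzygy hP X) A, ξ = 0) (ε : S.Ext X Z) :
    ∃ ζ : S.Ext X B, push S.E y ζ = ε := by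
  obtain ⟨δ, h⟩ := h
  obtain ⟨P, i, p, δ', hPP, hδ'⟩ := exists_syzygy_realizes hP X
  obtain ⟨f, rfl⟩ := hδ'.exists_push_eq ε (hPP.ext_eq_zero _)
  obtain ⟨g, rfl⟩ := h.exists_lift_of_pull f (H _)
  exact ⟨push S.E g δ', (push_comp _ _ _ _).symm⟩

lemma exists_pull_inflation_eq_of_cosyzygy (hI : S.EnoughInjectives) {A B Z : C} {x : A ⟶ B}
    {y : B ⟶ Z} (h : S.IsConflation x y) {M : C}
    (H : ∀ ξ : S.Ext Z (S.cosyzygy hI M), ξ = 0) (ε : S.Ext A M) :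
    ∃ ζ : S.Ext B M, pull S.E x ζ = ε := by
  obtain ⟨δ, h⟩ := h
  obtain ⟨I, j, q, δ', hII, hδ'⟩ := exists_cosyzygy_realizes hI M
  obtain ⟨f, rfl⟩ := hδ'.exists_pull_eq ε (hII.ext_eq_zero _)
  obtain ⟨g, rfl⟩ := h.exists_extend f (H _)
  exact ⟨pull S.E g δ', (pull_comp _ _ _ _).symm⟩

end EnoughProjectives

end Extriangulated

/-! ### Exact Hom sequences in a triangulated category -/

section Triangulated

open Pretriangulated

variable {C : Type u} [Category.{v} C] [Preadditive C] [HasShift C ℤ]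

lemma hom_shift_shift_eq_zero {X M : C} {n m : ℤ} (hm : n + 1 = m)
    (H : ∀ f : X ⟶ M⟦m⟧, f = 0) (f : X ⟶ M⟦n⟧⟦(1 : ℤ)⟧) : f = 0 := by
  rw [← cancel_mono ((shiftFunctorAdd' C n 1 m hm).inv.app M), H (f ≫ _), zero_comp]

variable [HasZeroObject C] [∀ n : ℤ, (shiftFunctor C n).Additive] [Pretriangulated C]

/-- Exactness of `Hom(X, B[n]) ⟶ Hom(X, Z[n]) ⟶ Hom(X, A[n + 1])`. -/
lemma exists_comp_shift_eq {A B Z : C} {x : A ⟶ B} {y : B ⟶ Z} {δ : Z ⟶ A⟦(1 : ℤ)⟧}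
    (hT : Triangle.mk x y δ ∈ distinguishedTriangles) {X : C} {n m : ℤ} (hm : n + 1 = m)
    (H : ∀ f : X ⟶ A⟦m⟧, f = 0) (f : X ⟶ Z⟦n⟧) :
    ∃ g : X ⟶ B⟦n⟧, g ≫ y⟦n⟧' = f := by
  obtain ⟨g, hg⟩ := Triangle.coyoneda_exact₃ _ (Triangle.shift_distinguished _ hT n) f
    (hom_shift_shift_eq_zero hm H _)
  -- The morphisms of the `n`-fold shifted triangle carry the sign `(-1)ⁿ`, which is absorbed into
  -- the lift.
  refine ⟨n.negOnePow • g, ?_⟩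
  rw [hg]
  change (n.negOnePow • g) ≫ y⟦n⟧' = g ≫ (n.negOnePow • y⟦n⟧')
  rw [Units.smul_def, Units.smul_def]
  exact (Preadditive.zsmul_comp _ _ _).trans (Preadditive.comp_zsmul _ _ _).symm

/-- Exactness of `Hom(B, M[1]) ⟶ Hom(A, M[1]) ⟶ Hom(Z, M[2])`. -/
lemma exists_comp_eq_of_shift {A B Z : C} {x : A ⟶ B} {y : B ⟶ Z} {δ : Z ⟶ A⟦(1 : ℤ)⟧}
    (hT : Triangle.mk x y δ ∈ distinguishedTriangles) {M : C}
    (H : ∀ f : Z ⟶ M⟦(2 : ℤ)⟧, f = 0) (f : A ⟶ M⟦(1 : ℤ)⟧) :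
    ∃ g : B ⟶ M⟦(1 : ℤ)⟧, x ≫ g = f := by
  obtain ⟨g, hg⟩ := Triangle.yoneda_exact₂ _
    (rot_of_distTriang _ (rot_of_distTriang _ hT)) (f⟦(1 : ℤ)⟧')
    (hom_shift_shift_eq_zero (m := 2) (by norm_num) H _)
  obtain ⟨g' : B ⟶ M⟦(1 : ℤ)⟧, rfl⟩ := (shiftFunctor C (1 : ℤ)).map_surjective g
  -- The second morphism of the twice rotated triangle is `-x⟦1⟧'`, hence the sign.
  refine ⟨-g', (shiftFunctor C (1 : ℤ)).map_injective ?_⟩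
  refine Eq.trans ?_ hg.symm
  rw [CategoryTheory.Functor.map_comp, CategoryTheory.Functor.map_neg]
  exact (Preadditive.comp_neg _ _).trans (Preadditive.neg_comp _ _).symm

end Triangulated

/-! ### Vanishing of higher extensions, uniformly in the three settings -/

namespace HigherExtensions

open Extriangulated

variable {C : Type u} [Category.{v} C] [Preadditive C] {S : Extriangulated.{w} C}

/-- All the groups `𝔼ᵏ⁺¹(A, M)` vanish. -/
def Vanishes (H : HigherExtensions S) (A M : C) : Prop :=
  ∀ (k : ℕ) (ξ : H.extSucc k A M), ξ = 0

lemma idClass_eq_zero_iff (H : HigherExtensions S) (X Y : ObjectProperty C) :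
    H.idClass X Y = 0 ↔ ∀ A M : C, X A → Y M → H.Vanishes A M := by
  constructor
  · intro h A M hA hM k
    have h0 : H.idObj X M = 0 := by
      apply le_antisymm _ zero_le
      rw [← h]
      exact le_sSup ⟨M, hM, rfl⟩
    -- An infimum over the empty set would be `∞`, not `0`. So some bound exists, and the infimum is
    -- attained.
    have hne : {d : ℕ∞ | ∃ m : ℕ, d = m ∧ ∀ k : ℕ, m ≤ k → ∀ A : C, X A →
        ∀ ξ : H.extSucc k A M, ξ = 0}.Nonempty := by
      by_contra hcon
      rw [idObj, Set.not_nonempty_iff_eq_empty.mp hcon] at h0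
      simp at h0
    obtain ⟨m, hm, hk⟩ := csInf_mem hne
    have hm0 : m = 0 := by
      rw [← idObj, h0] at hm
      exact_mod_cast hm.symm
    subst hm0
    exact hk k (Nat.zero_le _) A hA
  · intro h
    refine le_antisymm (sSup_le ?_) zero_le
    rintro d ⟨M, hM, rfl⟩
    exact sInf_le ⟨0, by simp, fun k _ A hA => h A M hA hM k⟩

variable {H : HigherExtensions S}

lemma vanishes_enough_iff (hP : S.EnoughProjectives) (hI : S.EnoughInjectives) (A M : C) :
    (enough hP hI : HigherExtensions S).Vanishes A M ↔
      ∀ (k : ℕ) (ξ : S.Ext ((S.syzygy hP)^[k] A) M), ξ = 0 := by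
  simp only [← ext_iterCosyzygy_eq_zero_iff hP hI]
  constructor
  · intro h k ξ
    exact congrArg ULift.down (h k ⟨ξ⟩)
  · intro h k ξ
    exact ULift.ext _ _ (h k ξ.down)

lemma Vanishes.ext_eq_zero {A M : C} (h : H.Vanishes A M) (δ : S.Ext A M) : δ = 0 := by
  cases H with
  | enough hP hI => exact congrArg ULift.down (h 0 ⟨δ⟩)
  | abelian hC φ _ _ =>
    apply (φ A M).injective
    rw [map_zero]
    exact congrArg ULift.down (h 0 ⟨φ A M δ⟩)
  | triangulated φ _ _ =>
    apply (φ A M).injective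
    rw [map_zero]
    exact congrArg ULift.down (h 0 ⟨φ A M δ⟩)

/-- Exactness of `𝔼ᵏ⁺¹(A, W) ⟶ 𝔼ᵏ⁺¹(A, M) ⟶ 𝔼ᵏ⁺²(A, K)`. -/
lemma Vanishes.of_conflation {A K W M : C} {x : K ⟶ W} {y : W ⟶ M} (hc : S.IsConflation x y)
    (hK : H.Vanishes A K) (hW : H.Vanishes A W) : H.Vanishes A M := by
  cases H with
  | enough hP hI =>
    rw [vanishes_enough_iff] at hK hW ⊢
    intro k ξ
    obtain ⟨ζ, rfl⟩ := exists_push_deflation_eq_of_syzygy hP hc (by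
      have := hK (k + 1)
      rwa [Function.iterate_succ_apply'] at this) ξ
    rw [hW k ζ, push_zero]
  | abelian hC φ _ hr =>
    obtain ⟨δ, hδ⟩ := hc
    rw [hr] at hδ
    let := hC.abelian
    have := HasExt.standard.{v, u} C
    obtain ⟨w, hE, _⟩ := hδ
    rintro k ⟨ξ⟩
    obtain ⟨ζ, hζ⟩ := Abelian.Ext.covariant_sequence_exact₃ A hE
      (show Abelian.Ext.{max u v} A M (k + 1) from ξ) rfl (congrArg ULift.down (hK (k + 1) ⟨_⟩))
    refine ULift.ext _ _ (hζ.symm.trans ?_)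
    rw [show ζ = 0 from congrArg ULift.down (hW k ⟨ζ⟩), Abelian.Ext.zero_comp]
    rfl
  | triangulated φ _ hr =>
    obtain ⟨δ, hδ⟩ := hc
    rw [hr] at hδ
    rintro k ⟨ξ⟩
    obtain ⟨g, hg⟩ := exists_comp_shift_eq hδ (m := ((k + 1 + 1 : ℕ) : ℤ)) (by simp)
      (fun f => congrArg ULift.down (hK (k + 1) ⟨f⟩)) ξ
    refine ULift.ext _ _ (hg.symm.trans ?_)
    rw [show g = 0 from congrArg ULift.down (hW k ⟨g⟩), zero_comp]
    rfl

/-- Exactness of `𝔼(X, B) ⟶ 𝔼(X, Z) ⟶ 𝔼²(X, A)`. -/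
lemma Vanishes.exists_push_eq {X A B Z : C} {x : A ⟶ B} {y : B ⟶ Z} (hX : H.Vanishes X A)
    (hc : S.IsConflation x y) (ε : S.Ext X Z) : ∃ ζ : S.Ext X B, push S.E y ζ = ε := by
  cases H with
  | enough hP hI =>
    rw [vanishes_enough_iff] at hX
    exact exists_push_deflation_eq_of_syzygy hP hc (hX 1) ε
  | abelian hC φ hn hr =>
    obtain ⟨δ, hδ⟩ := hc
    rw [hr] at hδ
    let := hC.abelian
    have := HasExt.standard.{v, u} C
    obtain ⟨w, hE, _⟩ := hδ
    obtain ⟨ζ, hζ⟩ := Abelian.Ext.covariant_sequence_exact₃ X hE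
      (show Abelian.Ext.{max u v} X Z 1 from φ X Z ε) rfl (congrArg ULift.down (hX 1 ⟨_⟩))
    obtain ⟨ξ, rfl⟩ := (φ X B).surjective ζ
    refine ⟨ξ, (φ X Z).injective (Eq.trans ?_ hζ)⟩
    have := hn (𝟙 X) y ξ
    rw [pull_id] at this
    rw [this]
    exact congrArg (fun t => t.comp (Abelian.Ext.mk₀ y) (add_zero 1))
      (Abelian.Ext.mk₀_id_comp (show Abelian.Ext.{max u v} X B 1 from φ X B ξ))
  | triangulated φ hn hr =>
    obtain ⟨δ, hδ⟩ := hc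
    rw [hr] at hδ
    obtain ⟨g, hg⟩ := exists_comp_shift_eq hδ (m := ((1 + 1 : ℕ) : ℤ)) (by simp)
      (fun f => congrArg ULift.down (hX 1 ⟨f⟩)) (φ X Z ε)
    refine ⟨(φ X B).symm g, (φ X Z).injective ?_⟩
    have := hn (𝟙 X) y ((φ X B).symm g)
    rw [pull_id, AddEquiv.apply_symm_apply] at this
    rw [this, Category.id_comp, hg]

/-- Exactness of `𝔼(B, M) ⟶ 𝔼(A, M) ⟶ 𝔼²(Z, M)`. -/
lemma Vanishes.exists_pull_eq {M A B Z : C} {x : A ⟶ B} {y : B ⟶ Z} (hM : H.Vanishes Z M)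
    (hc : S.IsConflation x y) (ε : S.Ext A M) : ∃ ζ : S.Ext B M, pull S.E x ζ = ε := by
  cases H with
  | enough hP hI =>
    exact exists_pull_inflation_eq_of_cosyzygy hI hc
      (fun ξ => congrArg ULift.down (hM 1 ⟨ξ⟩)) ε
  | abelian hC φ hn hr =>
    obtain ⟨δ, hδ⟩ := hc
    rw [hr] at hδ
    let := hC.abelian
    have := HasExt.standard.{v, u} C
    obtain ⟨w, hE, _⟩ := hδ
    obtain ⟨ζ, hζ⟩ := Abelian.Ext.contravariant_sequence_exact₁ hE M
      (show Abelian.Ext.{max u v} A M 1 from φ A M ε) (n₁ := 1 + 1) rfl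
      (congrArg ULift.down (hM 1 ⟨_⟩))
    obtain ⟨ξ, rfl⟩ := (φ B M).surjective ζ
    refine ⟨ξ, (φ A M).injective (Eq.trans ?_ hζ)⟩
    have := hn x (𝟙 M) ξ
    rw [push_id] at this
    rw [this]
    exact Abelian.Ext.comp_mk₀_id _
  | triangulated φ hn hr =>
    obtain ⟨δ, hδ⟩ := hc
    rw [hr] at hδ
    obtain ⟨g, hg⟩ := exists_comp_eq_of_shift hδ
      (fun f => congrArg ULift.down (hM 1 ⟨f⟩)) (φ A M ε)
    refine ⟨(φ B M).symm g, (φ A M).injective ?_⟩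
    have := hn x (𝟙 M) ((φ B M).symm g)
    rw [push_id, AddEquiv.apply_symm_apply] at this
    rw [this, CategoryTheory.Functor.map_id, Category.comp_id, hg]

end HigherExtensions

end Extri

namespace Extri

namespace Extriangulated

variable {C : Type u} [Category.{v} C] [Preadditive C] {S : Extriangulated.{w} C}

/-! ### Closure properties, resolutions and thick classes -/

section Classes

variable {P Q : ObjectProperty C}

lemma ClosedUnderSummands.of_iso (S : Extriangulated.{w} C) (hP : ClosedUnderSummands P) {A B : C}
    (e : A ≅ B) (hA : P A) : P B := by
  obtain ⟨O, hO⟩ := S.exists_isZero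
  refine (hP { pt := A, fst := e.hom, snd := 0, inl := e.inv, inr := 0,
               inr_snd := hO.eq_of_src _ _ : BinaryBicone B O } ?_ hA).1
  change e.hom ≫ e.inv + (0 : A ⟶ O) ≫ (0 : O ⟶ A) = 𝟙 A
  simp

lemma ClosedUnderSummands.of_realizes_zero (hP : ClosedUnderSummands P) {A B Z : C} {x : A ⟶ B}
    {y : B ⟶ Z} (h : S.Realizes x y (0 : S.Ext Z A)) (hB : P B) : P A ∧ P Z := by
  obtain ⟨b, hb, rfl⟩ := h.exists_isDirectSum
  exact hP b hb hB

lemma ClosedUnderSummands.of_isZero (hP : ClosedUnderSummands P) {A O : C} (hA : P A)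
    (hO : IsZero O) : P O :=
  (hP _ (isDirectSum_biconeZeroRight A hO) hA).2

lemma HasResolution.mono (h : P ≤ Q) {n : ℕ} {M : C} (hM : S.HasResolution P n M) :
    S.HasResolution Q n M := by
  induction n generalizing M with
  | zero =>
    obtain ⟨X₀, hX, e⟩ := hM
    exact ⟨X₀, h _ hX, e⟩
  | succ n ih =>
    obtain ⟨K, X₀, x, y, hX, hc, hK⟩ := hM
    exact ⟨K, X₀, x, y, h _ hX, hc, ih hK⟩

lemma wedge_mono (h : P ≤ Q) : S.wedge P ≤ S.wedge Q := fun _ ⟨n, hM⟩ => ⟨n, hM.mono h⟩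

lemma le_wedge : P ≤ S.wedge P := fun M hM => ⟨0, M, hM, ⟨Iso.refl M⟩⟩

lemma wedge_of_conflation {K X₀ M : C} {x : K ⟶ X₀} {y : X₀ ⟶ M} (hc : S.IsConflation x y)
    (hX : P X₀) (hK : S.wedge P K) : S.wedge P M := by
  obtain ⟨n, hK⟩ := hK
  exact ⟨n + 1, K, X₀, x, y, hX, hc, hK⟩

lemma wedge_le (hP : ClosedUnderSummands P) (hc : S.ClosedUnderCones P) : S.wedge P ≤ P := by
  rintro M ⟨n, hM⟩
  induction n generalizing M with
  | zero =>
    obtain ⟨X₀, hX, ⟨e⟩⟩ := hM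
    exact hP.of_iso S e hX
  | succ n ih =>
    obtain ⟨K, X₀, x, y, hX, h, hK⟩ := hM
    exact hc x y h (ih K hK) hX

lemma le_thick (P : ObjectProperty C) : P ≤ S.thick P := fun _ hM _ _ hT => hT _ hM

lemma thick_le (hQ : S.IsThick Q) (h : P ≤ Q) : S.thick P ≤ Q := fun _ hM => hM Q hQ h

lemma isThick_thick (P : ObjectProperty C) : S.IsThick (S.thick P) := by
  have hs : ClosedUnderSummands (S.thick P) := fun _ _ b hb h =>
    ⟨fun T hT hPT => (hT.1.summands b hb (h T hT hPT)).1,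
      fun T hT hPT => (hT.1.summands b hb (h T hT hPT)).2⟩
  exact ⟨⟨S.hasZero_thick P, S.closedUnderExtensions_thick P, hs,
      fun _ _ _ x y h hB hZ T hT hPT => hT.1.cocones x y h (hB T hT hPT) (hZ T hT hPT)⟩,
    ⟨S.hasZero_thick P, S.closedUnderExtensions_thick P, hs,
      fun _ _ _ x y h hA hB T hT hPT => hT.2.cones x y h (hA T hT hPT) (hB T hT hPT)⟩⟩

/-- The kernel of a deflation from an object with an `X`-resolution to an object of a left thick
class `X` has an `X`-resolution of the same length. -/
lemma IsLeftThick.hasResolution_cocone (hP : S.IsLeftThick P) {n : ℕ} {K N F : C} {x : K ⟶ N}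
    {y : N ⟶ F} (hc : S.IsConflation x y) (hN : S.HasResolution P n N) (hF : P F) :
    S.HasResolution P n K := by
  cases n with
  | zero =>
    obtain ⟨X₀, hX, ⟨e⟩⟩ := hN
    exact ⟨K, hP.cocones x y hc (hP.summands.of_iso S e hX) hF, ⟨Iso.refl K⟩⟩
  | succ n =>
    obtain ⟨K', X₀, x', y', hX, hc', hK'⟩ := hN
    obtain ⟨L, l, d, e, hl, hd⟩ := hc'.comp_deflation hc
    exact ⟨K', L, d, e, hP.cocones _ _ hl hX hF, hd, hK'⟩

lemma isConflation_restrict_iff {D : ObjectProperty C} (h0 : HasZero D)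
    (hD : S.ClosedUnderExtensions D) {A B Z : D.FullSubcategory} (x : A ⟶ B) (y : B ⟶ Z) :
    (S.restrict h0 hD).IsConflation x y ↔ S.IsConflation x.hom y.hom :=
  exists_congr fun δ => S.restrictS_eq_iff hD x y δ

lemma ClosedUnderSummands.inverseImage (hP : ClosedUnderSummands P) (D : ObjectProperty C) :
    ClosedUnderSummands (P.inverseImage D.ι) :=
  fun _ _ b hb h => hP (D.ι.mapBinaryBicone b) (isDirectSum_map b hb) h

lemma ClosedUnderSummands.of_inverseImage {D : ObjectProperty C} (hD : ClosedUnderSummands D)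
    (hPD : P ≤ D) (hP : ClosedUnderSummands (P.inverseImage D.ι)) : ClosedUnderSummands P := by
  intro A A' b hb h
  obtain ⟨hA, hA'⟩ := hD b hb (hPD _ h)
  exact hP (A := ⟨A, hA⟩) (A' := ⟨A', hA'⟩)
    { pt := ⟨b.pt, hPD _ h⟩
      fst := ObjectProperty.homMk b.fst
      snd := ObjectProperty.homMk b.snd
      inl := ObjectProperty.homMk b.inl
      inr := ObjectProperty.homMk b.inr
      inl_fst := ObjectProperty.hom_ext _ b.inl_fst
      inl_snd := ObjectProperty.hom_ext _ b.inl_snd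
      inr_fst := ObjectProperty.hom_ext _ b.inr_fst
      inr_snd := ObjectProperty.hom_ext _ b.inr_snd }
    (ObjectProperty.hom_ext _ hb) h

end Classes

end Extriangulated

open Extriangulated

/-! ### From left Frobenius pairs to cotorsion pairs -/

namespace HigherExtensions.IsLeftFrobeniusPair

variable {C : Type u} [Category.{v} C] [Preadditive C] {S : Extriangulated.{w} C}
  {H : HigherExtensions S} {X ω : ObjectProperty C}

/-- Dimension shifting: for `K ⟶ W ⟶ G` with `W ∈ ω`, the group `𝔼ᵏ⁺¹(A, G)` lies between `𝔼ᵏ⁺¹(A,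
W)` and `𝔼ᵏ⁺²(A, K)`. All degrees have to be carried through the induction. -/
lemma vanishes_of_wedge (hF : H.IsLeftFrobeniusPair X ω) {A G : C} (hA : X A)
    (hG : S.wedge ω G) : H.Vanishes A G := by
  have h := (H.idClass_eq_zero_iff X ω).mp hF.injective
  obtain ⟨n, hG⟩ := hG
  induction n generalizing G with
  | zero =>
    obtain ⟨W, hW, ⟨e⟩⟩ := hG
    exact h A G hA (hF.summands.of_iso S e hW)
  | succ n ih =>
    obtain ⟨K, W, x, y, hW, hc, hK⟩ := hG
    exact (ih hK).of_conflation hc (h A W hA hW)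

/-- For `K' ⟶ X₀ ⟶ K`, embed `K'` into `G'` by induction and push out: this gives `G' ⟶ P ⟶ K` with
`P ∈ X`, an extension of `F'` by `X₀`. Embedding `P` into `W ∈ ω`, the cokernel of `G' ⟶ W` contains
`K` with quotient in `X`. -/
lemma exists_hasResolution_right (hF : H.IsLeftFrobeniusPair X ω) {n : ℕ} {K : C}
    (hK : S.HasResolution X n K) : ∃ (G F : C) (i : K ⟶ G) (p : G ⟶ F),
      S.HasResolution ω n G ∧ X F ∧ S.IsConflation i p := by
  induction n generalizing K with
  | zero =>
    obtain ⟨X₀, hX, ⟨e⟩⟩ := hK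
    obtain ⟨W, M', i, p, hW, hM', hc⟩ :=
      hF.cogenerator.2 K (hF.leftThick.summands.of_iso S e hX)
    exact ⟨W, M', i, p, ⟨W, hW, ⟨Iso.refl W⟩⟩, hM', hc⟩
  | succ n ih =>
    obtain ⟨K', X₀, x, y, hX, hc, hK'⟩ := hK
    obtain ⟨G', F', i, p, hG', hF', hc'⟩ := ih hK'
    obtain ⟨P, f₁, g₂, f₂, g₁, h₁, h₂⟩ := exists_pushout hc hc'
    obtain ⟨W, F, j, q, hW, hFF, hj⟩ :=
      hF.cogenerator.2 P (hF.leftThick.extensions _ _ h₁ hX hF')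
    obtain ⟨G, k, d, e, hk, hd⟩ := h₂.comp_inflation hj
    exact ⟨G, F, d, e, ⟨G', W, _, k, hW, hk, hG'⟩, hFF, hd⟩

/-- One pushout along the right approximation of the first syzygy. The kernel has a resolution one
step shorter than that of `M`, which drives the induction for direct summands. -/
lemma exists_hasResolution_left (hF : H.IsLeftFrobeniusPair X ω) {n : ℕ} {M : C}
    (hM : S.HasResolution X (n + 1) M) : ∃ (G F : C) (i : G ⟶ F) (p : F ⟶ M),
      S.HasResolution ω n G ∧ X F ∧ S.IsConflation i p := by
  obtain ⟨K, X₀, x, y, hX, hc, hK⟩ := hM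
  obtain ⟨G, F, i, p, hG, hFF, hc'⟩ := hF.exists_hasResolution_right hK
  obtain ⟨P, f₁, g₂, f₂, g₁, h₁, h₂⟩ := exists_pushout hc hc'
  exact ⟨G, P, f₂, g₁, hG, hF.leftThick.extensions _ _ h₁ hX hFF, h₂⟩

lemma exists_right_approximation (hF : H.IsLeftFrobeniusPair X ω) {M : C} (hM : S.wedge X M) :
    ∃ (G F : C) (i : M ⟶ G) (p : G ⟶ F), S.wedge ω G ∧ X F ∧ S.IsConflation i p := by
  obtain ⟨n, hM⟩ := hM
  obtain ⟨G, F, i, p, hG, h⟩ := hF.exists_hasResolution_right hM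
  exact ⟨G, F, i, p, ⟨n, hG⟩, h⟩

lemma wedge_of_isZero (hF : H.IsLeftFrobeniusPair X ω) {O : C} (hO : IsZero O) :
    S.wedge ω O := by
  obtain ⟨A, _, hA⟩ := hF.leftThick.hasZero
  obtain ⟨W, _, _, _, hW, _⟩ := hF.cogenerator.2 A hA
  exact le_wedge _ (hF.summands.of_isZero hW hO)

lemma exists_left_approximation (hF : H.IsLeftFrobeniusPair X ω) {M : C} (hM : S.wedge X M) :
    ∃ (G F : C) (i : G ⟶ F) (p : F ⟶ M), S.wedge ω G ∧ X F ∧ S.IsConflation i p := by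
  obtain ⟨_ | n, hM⟩ := hM
  · obtain ⟨X₀, hX, ⟨e⟩⟩ := hM
    obtain ⟨O, hO⟩ := S.exists_isZero
    exact ⟨O, M, 0, 𝟙 M, hF.wedge_of_isZero hO, hF.leftThick.summands.of_iso S e hX,
      isConflation_zero_id M hO⟩
  · obtain ⟨G, F, i, p, hG, h⟩ := hF.exists_hasResolution_left hM
    exact ⟨G, F, i, p, ⟨n, hG⟩, h⟩

/-- The conflation splits because `𝔼(F, G) = 0`, so it lifts along `W ⟶ G` to an extension of `F` by
`W`, with the same kernel `K`. The point is that the length does not grow. -/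
lemma hasResolution_extension (hF : H.IsLeftFrobeniusPair X ω) {n : ℕ} {G P F : C} {i : G ⟶ P}
    {p : P ⟶ F} (hc : S.IsConflation i p) (hG : S.HasResolution ω n G) (hFF : X F) :
    S.HasResolution X n P := by
  cases n with
  | zero =>
    obtain ⟨W, hW, ⟨e⟩⟩ := hG
    exact ⟨P, hF.leftThick.extensions i p hc
      (hF.cogenerator.1 _ (hF.summands.of_iso S e hW)) hFF, ⟨Iso.refl P⟩⟩
  | succ n =>
    obtain ⟨δ, hδ⟩ := hc
    have h0 : δ = 0 := (hF.vanishes_of_wedge hFF ⟨_, hG⟩).ext_eq_zero δ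
    obtain ⟨K, W, x, y, hW, hc', hK⟩ := hG
    obtain ⟨Q, i', p', k, q, h₁, h₂⟩ := exists_lift_conflation hc' hδ (δ' := 0)
      (by rw [push_zero, h0])
    exact ⟨K, Q, k, q, hF.leftThick.extensions _ _ h₁ (hF.cogenerator.1 _ hW) hFF, h₂,
      hK.mono hF.cogenerator.1⟩

/-- Approximate `A` by `G ⟶ F ⟶ A`. As `𝔼²(Z, G) = 0`, the class of the extension lifts to `𝔼(Z,
F)`, and the lifted extension lies in `X` and maps onto `B` with kernel `G`. -/
lemma wedge_extension_of_right (hF : H.IsLeftFrobeniusPair X ω) {A B Z : C} {x : A ⟶ B}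
    {y : B ⟶ Z} (hc : S.IsConflation x y) (hA : S.wedge X A) (hZ : X Z) : S.wedge X B := by
  obtain ⟨δ, hδ⟩ := hc
  obtain ⟨G, F, i, p, hG, hFF, hc'⟩ := hF.exists_left_approximation hA
  obtain ⟨δ', h⟩ := (hF.vanishes_of_wedge hZ hG).exists_push_eq hc' δ
  obtain ⟨Q, _, _, _, _, h₁, h₂⟩ := exists_lift_conflation hc' hδ h
  exact wedge_of_conflation h₂ (hF.leftThick.extensions _ _ h₁ hFF hZ)
    (wedge_mono hF.cogenerator.1 _ hG)

lemma closedUnderExtensions_wedge (hF : H.IsLeftFrobeniusPair X ω) :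
    S.ClosedUnderExtensions (S.wedge X) := by
  rintro A B Z x y hc hA ⟨n, hZ⟩
  induction n generalizing A B Z with
  | zero =>
    obtain ⟨X₀, hX, ⟨e⟩⟩ := hZ
    exact hF.wedge_extension_of_right hc hA (hF.leftThick.summands.of_iso S e hX)
  | succ n ih =>
    obtain ⟨K, F, k, f, hFF, hc', hK⟩ := hZ
    -- `P` is an extension of `F` by `A` and maps onto `B` with kernel `K`. Approximating `P` by `F'
    -- ∈ X`, the kernel of `F' ⟶ B` is an extension of `K` by `G`, and `K` has a shorter resolution
    -- than `Z`.
    obtain ⟨P, _, _, _, _, h₁, h₂⟩ := exists_pullback hc hc'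
    obtain ⟨G, F', i, p, hG, hF', hP⟩ :=
      hF.exists_left_approximation (hF.wedge_extension_of_right h₁ hA hFF)
    obtain ⟨N, _, d, e, hN, hd⟩ := hP.comp_deflation h₂
    exact wedge_of_conflation hN hF' (ih d e hd (wedge_mono hF.cogenerator.1 _ hG) hK)

/-- Approximating `B` by `F ∈ X`, the kernel of the composite `F ⟶ B ⟶ Z` is an extension of `A` by
`G`. -/
lemma closedUnderCones_wedge (hF : H.IsLeftFrobeniusPair X ω) :
    S.ClosedUnderCones (S.wedge X) := by
  intro A B Z x y hc hA hB
  obtain ⟨G, F, i, p, hG, hFF, hc'⟩ := hF.exists_left_approximation hB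
  obtain ⟨N, _, d, e, hN, hd⟩ := hc'.comp_deflation hc
  exact wedge_of_conflation hN hFF
    (hF.closedUnderExtensions_wedge d e hd (wedge_mono hF.cogenerator.1 _ hG) hA)

/-- Pulling `B` back along an approximation `F ⟶ Z` replaces `A ⟶ B ⟶ Z` by `A ⟶ P ⟶ F` with `F ∈
X`, where left thickness of `X` applies. -/
lemma closedUnderCocones_wedge (hF : H.IsLeftFrobeniusPair X ω) :
    S.ClosedUnderCocones (S.wedge X) := by
  intro A B Z x y hc hB hZ
  obtain ⟨G, F, i, p, hG, hFF, hc'⟩ := hF.exists_left_approximation hZ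
  obtain ⟨P, _, _, _, _, h₁, h₂⟩ := exists_pullback hc hc'
  obtain ⟨n, hP⟩ :=
    hF.closedUnderExtensions_wedge _ _ h₂ (wedge_mono hF.cogenerator.1 _ hG) hB
  exact ⟨n, hF.leftThick.hasResolution_cocone h₁ hP hFF⟩

lemma hasResolution_summands (hF : H.IsLeftFrobeniusPair X ω) {n : ℕ} {A A' : C}
    (b : BinaryBicone A A') (hb : IsDirectSum b) (h : S.HasResolution X n b.pt) :
    S.HasResolution X n A ∧ S.HasResolution X n A' := by
  induction n generalizing A A' with
  | zero =>
    obtain ⟨X₀, hX, ⟨e⟩⟩ := h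
    obtain ⟨hA, hA'⟩ := hF.leftThick.summands b hb (hF.leftThick.summands.of_iso S e hX)
    exact ⟨⟨A, hA, ⟨Iso.refl A⟩⟩, ⟨A', hA', ⟨Iso.refl A'⟩⟩⟩
  | succ n ih =>
    obtain ⟨G, F, i, p, hG, hFF, hc⟩ := hF.exists_hasResolution_left h
    have h₁ : S.IsConflation b.inr b.fst :=
      ⟨0, S.s_zero { pt := b.pt, fst := b.snd, snd := b.fst, inl := b.inr, inr := b.inl }
        (by simpa [IsDirectSum, add_comm] using hb)⟩
    have h₂ : S.IsConflation b.inl b.snd := ⟨0, S.s_zero b hb⟩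
    obtain ⟨L, l, _, _, ⟨ε, hL⟩, _⟩ := hc.comp_deflation h₁
    obtain ⟨L', l', _, _, ⟨ε', hL'⟩, _⟩ := hc.comp_deflation h₂
    obtain ⟨bL, hbL⟩ := S.exists_isDirectSum L L'
    obtain ⟨bF, hbF⟩ := S.exists_isDirectSum F F
    have hsum : S.IsConflation (sumMap bL bF l l') (sumMap bF b (p ≫ b.fst) (p ≫ b.snd)) :=
      ⟨_, S.s_sum _ _ _ _ _ _ hL hL' bL bF b hbL hbF hb⟩
    -- `L` and `L'` are the kernels of `F ⟶ A` and `F ⟶ A'`. The pullback `P` of `F ⊕ F` and `F`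
    -- over `A ⊕ A'` is an extension of `F ⊕ F` by `G`, so it has a resolution of length `n`. So
    -- does `L ⊕ L'`, the kernel of `P ⟶ F`, and the induction hypothesis splits it.
    obtain ⟨P, _, _, _, _, hP₁, hP₂⟩ := exists_pullback hsum hc
    have hFF' : X bF.pt := S.prop_of_isDirectSum hF.leftThick.extensions bF hbF hFF hFF
    obtain ⟨hA, hA'⟩ := ih bL hbL
      (hF.leftThick.hasResolution_cocone hP₁ (hF.hasResolution_extension hP₂ hG hFF') hFF)
    exact ⟨⟨L, F, _, _, hFF, ⟨_, hL⟩, hA⟩, ⟨L', F, _, _, hFF, ⟨_, hL'⟩, hA'⟩⟩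

lemma isThick_wedge (hF : H.IsLeftFrobeniusPair X ω) : S.IsThick (S.wedge X) := by
  have h0 : HasZero (S.wedge X) := by
    obtain ⟨O, hO, h⟩ := hF.leftThick.hasZero
    exact ⟨O, hO, le_wedge _ h⟩
  have hs : ClosedUnderSummands (S.wedge X) := fun A A' b hb ⟨n, h⟩ =>
    ⟨⟨n, (hF.hasResolution_summands b hb h).1⟩, ⟨n, (hF.hasResolution_summands b hb h).2⟩⟩
  exact ⟨⟨h0, hF.closedUnderExtensions_wedge, hs, hF.closedUnderCocones_wedge⟩,
    ⟨h0, hF.closedUnderExtensions_wedge, hs, hF.closedUnderCones_wedge⟩⟩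

lemma thick_eq_wedge (hF : H.IsLeftFrobeniusPair X ω) : S.thick X = S.wedge X :=
  le_antisymm (thick_le hF.isThick_wedge le_wedge)
    ((wedge_mono (le_thick X)).trans
      (wedge_le (isThick_thick X).1.summands (isThick_thick X).2.cones))

/-- If `𝔼(X, M) = 0`, the conflation `M ⟶ W ⟶ M'` from the cogenerator splits and `M` is a summand
of `W ∈ ω`. -/
lemma mem_iff (hF : H.IsLeftFrobeniusPair X ω) (M : C) :
    ω M ↔ X M ∧ ∀ A : C, X A → ∀ δ : S.Ext A M, δ = 0 := by
  constructor
  · exact fun hM => ⟨hF.cogenerator.1 M hM, fun A hA δ =>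
      (hF.vanishes_of_wedge hA (le_wedge M hM)).ext_eq_zero δ⟩
  · rintro ⟨hM, h⟩
    obtain ⟨W, M', x, y, hW, hM', δ, hδ⟩ := hF.cogenerator.2 M hM
    obtain rfl := h M' hM' δ
    exact (hF.summands.of_realizes_zero hδ hW).1

/-- In a left approximation `G ⟶ F ⟶ M`, orthogonality of `G` and `M` to `X` passes to `F`. Then `F
∈ ω` by `mem_iff`, and the approximation starts an `ω`-resolution of `M`. -/
lemma wedge_iff (hF : H.IsLeftFrobeniusPair X ω) (M : C) :
    S.wedge ω M ↔ S.wedge X M ∧ ∀ A : C, X A → ∀ δ : S.Ext A M, δ = 0 := by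
  constructor
  · exact fun hM => ⟨wedge_mono hF.cogenerator.1 M hM, fun A hA δ =>
      (hF.vanishes_of_wedge hA hM).ext_eq_zero δ⟩
  · rintro ⟨hM, h⟩
    obtain ⟨G, F, i, p, hG, hFF, δ, hδ⟩ := hF.exists_left_approximation hM
    refine wedge_of_conflation ⟨δ, hδ⟩ ((hF.mem_iff F).mpr ⟨hFF, fun A hA ε => ?_⟩) hG
    obtain ⟨ζ, rfl⟩ := hδ.exists_push_inflation_eq ε (h A hA _)
    rw [(hF.vanishes_of_wedge hA hG).ext_eq_zero ζ, push_zero]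

lemma closedUnderSummands_wedge (hF : H.IsLeftFrobeniusPair X ω) :
    ClosedUnderSummands (S.wedge ω) := by
  intro A A' b hb h
  obtain ⟨hX, h⟩ := (hF.wedge_iff _).mp h
  obtain ⟨hA, hA'⟩ := hF.isThick_wedge.1.summands b hb hX
  refine ⟨(hF.wedge_iff A).mpr ⟨hA, fun B hB δ => ?_⟩,
    (hF.wedge_iff A').mpr ⟨hA', fun B hB δ => ?_⟩⟩
  · rw [← push_id S.E δ, ← b.inl_fst, push_comp, h B hB (push S.E b.inl δ), push_zero]
  · rw [← push_id S.E δ, ← b.inr_snd, push_comp, h B hB (push S.E b.inr δ), push_zero]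

lemma idClass_wedge (hF : H.IsLeftFrobeniusPair X ω) : H.idClass X (S.wedge ω) = 0 :=
  (H.idClass_eq_zero_iff _ _).mpr fun _ _ => hF.vanishes_of_wedge

lemma inf_wedge (hF : H.IsLeftFrobeniusPair X ω) : X ⊓ S.wedge ω = ω := by
  ext M
  refine ⟨fun h => (hF.mem_iff M).mpr ⟨h.1, ((hF.wedge_iff M).mp h.2).2⟩, fun h => ?_⟩
  exact ⟨hF.cogenerator.1 M h, le_wedge M h⟩

lemma isCotorsionPairInThick (hF : H.IsLeftFrobeniusPair X ω) :
    S.IsCotorsionPairInThick X (S.wedge ω) where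
  left_le := le_thick X
  right_le := (wedge_mono hF.cogenerator.1).trans hF.thick_eq_wedge.ge
  isCotorsionPair :=
    { left_summands := hF.leftThick.summands.inverseImage _
      right_summands := hF.closedUnderSummands_wedge.inverseImage _
      ext_zero := fun _ _ hA hB δ => (hF.vanishes_of_wedge hA hB).ext_eq_zero δ
      left_complete := fun M => by
        obtain ⟨G, F, i, p, hG, hFF, hc⟩ :=
          hF.exists_left_approximation (hF.thick_eq_wedge.le _ M.property)
        exact ⟨⟨G, hF.thick_eq_wedge.ge _ (wedge_mono hF.cogenerator.1 _ hG)⟩,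
          ⟨F, le_thick X F hFF⟩, ObjectProperty.homMk i, ObjectProperty.homMk p, hG, hFF,
          (isConflation_restrict_iff _ _ _ _).mpr hc⟩
      right_complete := fun M => by
        obtain ⟨G, F, i, p, hG, hFF, hc⟩ :=
          hF.exists_right_approximation (hF.thick_eq_wedge.le _ M.property)
        exact ⟨⟨G, hF.thick_eq_wedge.ge _ (wedge_mono hF.cogenerator.1 _ hG)⟩,
          ⟨F, le_thick X F hFF⟩, ObjectProperty.homMk i, ObjectProperty.homMk p, hG, hFF,
          (isConflation_restrict_iff _ _ _ _).mpr hc⟩ }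

end HigherExtensions.IsLeftFrobeniusPair

/-! ### From cotorsion pairs to left Frobenius pairs -/

namespace Extriangulated.IsCotorsionPairInThick

variable {C : Type u} [Category.{v} C] [Preadditive C] {S : Extriangulated.{w} C}
  {H : HigherExtensions S} {F G : ObjectProperty C}

lemma ext_eq_zero (h : S.IsCotorsionPairInThick F G) {A B : C} (hA : F A) (hB : G B)
    (δ : S.Ext A B) : δ = 0 :=
  h.isCotorsionPair.ext_zero ⟨A, h.left_le A hA⟩ ⟨B, h.right_le B hB⟩ hA hB δ

lemma left_summands (h : S.IsCotorsionPairInThick F G) : ClosedUnderSummands F :=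
  (isThick_thick F).1.summands.of_inverseImage h.left_le h.isCotorsionPair.left_summands

lemma right_summands (h : S.IsCotorsionPairInThick F G) : ClosedUnderSummands G :=
  (isThick_thick F).1.summands.of_inverseImage h.right_le h.isCotorsionPair.right_summands

lemma left_complete (h : S.IsCotorsionPairInThick F G) {M : C} (hM : S.thick F M) :
    ∃ (B A : C) (x : B ⟶ A) (y : A ⟶ M), G B ∧ F A ∧ S.IsConflation x y := by
  obtain ⟨B, A, x, y, hB, hA, hc⟩ := h.isCotorsionPair.left_complete ⟨M, hM⟩
  exact ⟨B.obj, A.obj, x.hom, y.hom, hB, hA, (isConflation_restrict_iff _ _ _ _).mp hc⟩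

lemma right_complete (h : S.IsCotorsionPairInThick F G) {M : C} (hM : S.thick F M) :
    ∃ (B A : C) (x : M ⟶ B) (y : B ⟶ A), G B ∧ F A ∧ S.IsConflation x y := by
  obtain ⟨B, A, x, y, hB, hA, hc⟩ := h.isCotorsionPair.right_complete ⟨M, hM⟩
  exact ⟨B.obj, A.obj, x.hom, y.hom, hB, hA, (isConflation_restrict_iff _ _ _ _).mp hc⟩

/-- An object of `Thick(F)` left orthogonal to `G` splits off from its approximation in `F`. In this
form, closure properties of `F` become statements about exact sequences of `𝔼`. -/
lemma left_iff (h : S.IsCotorsionPairInThick F G) (M : C) :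
    F M ↔ S.thick F M ∧ ∀ B : C, G B → ∀ δ : S.Ext M B, δ = 0 := by
  refine ⟨fun hM => ⟨h.left_le M hM, fun B hB δ => h.ext_eq_zero hM hB δ⟩, ?_⟩
  rintro ⟨hM, h0⟩
  obtain ⟨B, A, x, y, hB, hA, δ, hδ⟩ := h.left_complete hM
  obtain rfl := h0 B hB δ
  exact (h.left_summands.of_realizes_zero hδ hA).2

lemma right_iff (h : S.IsCotorsionPairInThick F G) (M : C) :
    G M ↔ S.thick F M ∧ ∀ A : C, F A → ∀ δ : S.Ext A M, δ = 0 := by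
  refine ⟨fun hM => ⟨h.right_le M hM, fun A hA δ => h.ext_eq_zero hA hM δ⟩, ?_⟩
  rintro ⟨hM, h0⟩
  obtain ⟨B, A, x, y, hB, hA, δ, hδ⟩ := h.right_complete hM
  obtain rfl := h0 A hA δ
  exact (h.right_summands.of_realizes_zero hδ hB).1

lemma isLeftThick (h : S.IsCotorsionPairInThick F G) (hid : H.idClass F G = 0) :
    S.IsLeftThick F where
  hasZero := by
    obtain ⟨O, hO, hT⟩ := S.hasZero_thick F
    obtain ⟨_, A, _, _, _, hA, _⟩ := h.left_complete hT
    exact ⟨O, hO, h.left_summands.of_isZero hA hO⟩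
  extensions := by
    rintro A B Z x y ⟨δ, hδ⟩ hA hZ
    refine (h.left_iff B).mpr ⟨S.closedUnderExtensions_thick F x y ⟨δ, hδ⟩ (h.left_le A hA)
      (h.left_le Z hZ), fun M hM ε => ?_⟩
    obtain ⟨ζ, rfl⟩ := hδ.exists_pull_deflation_eq ε (h.ext_eq_zero hA hM _)
    rw [h.ext_eq_zero hZ hM ζ, pull_zero]
  summands := h.left_summands
  cocones := by
    intro A B Z x y hc hB hZ
    refine (h.left_iff A).mpr ⟨(isThick_thick F).1.cocones x y hc (h.left_le B hB)
      (h.left_le Z hZ), fun M hM ε => ?_⟩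
    -- Here `id_F(G) = 0` is needed beyond `𝔼`: a class on `A` extends to `B` because `𝔼²(Z, M) =
    -- 0`.
    obtain ⟨ζ, rfl⟩ :=
      ((H.idClass_eq_zero_iff F G).mp hid Z M hZ hM).exists_pull_eq hc ε
    rw [h.ext_eq_zero hB hM ζ, pull_zero]

lemma isLeftFrobeniusPair (h : S.IsCotorsionPairInThick F G) (hid : H.idClass F G = 0) :
    H.IsLeftFrobeniusPair F (F ⊓ G) where
  leftThick := h.isLeftThick hid
  summands := fun _ _ b hb hM =>
    ⟨⟨(h.left_summands b hb hM.1).1, (h.right_summands b hb hM.2).1⟩,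
      ⟨(h.left_summands b hb hM.1).2, (h.right_summands b hb hM.2).2⟩⟩
  injective := (H.idClass_eq_zero_iff _ _).mpr fun A M hA hM =>
    (H.idClass_eq_zero_iff F G).mp hid A M hA hM.2
  cogenerator := by
    refine ⟨inf_le_left, fun M hM => ?_⟩
    obtain ⟨B, A, x, y, hB, hA, hc⟩ := h.right_complete (h.left_le M hM)
    -- `B ∈ G` also lies in `F`, being an extension of `A` by `M`.
    exact ⟨B, A, x, y, ⟨(h.isLeftThick hid).extensions x y hc hM hA, hB⟩, hA, hc⟩

/-- Both sides are the right orthogonal of `F` in `Thick(F)`, which equals `F^∧` because `(F, F ∩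
G)` is a left Frobenius pair. -/
lemma wedge_inf (h : S.IsCotorsionPairInThick F G) (hid : H.idClass F G = 0) :
    S.wedge (F ⊓ G) = G := by
  have hF := h.isLeftFrobeniusPair hid
  ext M
  rw [hF.wedge_iff, h.right_iff, hF.thick_eq_wedge]

end Extriangulated.IsCotorsionPairInThick

end Extri

theorem corollary5p8 {C : Type u} [Category.{v} C] [Preadditive C]
    (S : Extri.Extriangulated.{w} C) (H : Extri.HigherExtensions S) :
    let leftFrobeniusPairs : Set (ObjectProperty C × ObjectProperty C) :=
      {p | H.IsLeftFrobeniusPair p.1 p.2}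
    let cotorsionPairs : Set (ObjectProperty C × ObjectProperty C) :=
      {p | S.IsCotorsionPairInThick p.1 p.2 ∧ H.idClass p.1 p.2 = 0}
    let Φ : ObjectProperty C × ObjectProperty C → ObjectProperty C × ObjectProperty C :=
      fun p => (p.1, S.wedge p.2)
    let Ψ : ObjectProperty C × ObjectProperty C → ObjectProperty C × ObjectProperty C :=
      fun p => (p.1, p.1 ⊓ p.2)
    Set.MapsTo Φ leftFrobeniusPairs cotorsionPairs ∧
      Set.MapsTo Ψ cotorsionPairs leftFrobeniusPairs ∧
      Set.InvOn Ψ Φ leftFrobeniusPairs cotorsionPairs := by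
  intro leftFrobeniusPairs cotorsionPairs Φ Ψ
  refine ⟨?_, ?_, ?_, ?_⟩
  · exact fun p hp => ⟨hp.isCotorsionPairInThick, hp.idClass_wedge⟩
  · exact fun p hp => hp.1.isLeftFrobeniusPair hp.2
  · exact fun p hp => Prod.ext rfl hp.inf_wedge
  · exact fun p hp => Prod.ext rfl (hp.1.wedge_inf hp.2)
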